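/- **Setting.** Let $I=[0,1]$, $\Omega=I^{\mathbb Z}$, let $d_I$ be a metric on $I$ inducing the usual topology, $\theta\in(0,1)$, $\beta>0$, and $d(x,y)=\sup_{k\in\mathbb Z}\theta^{|k|}d_I(x_k,y_k)$ on $\Omega$. Let $\tau:I\to I$ be a map with $b\ge 1$ full branches: there are maps $\zeta_1,\dots,\zeta_b:I\to I$ (the inverse branches) such that for every $x\in(0,1)$ the points $\zeta_1x,\dots,\zeta_bx$ are distinct and form $\tau^{-1}\{x\}$, and there is $\eta\in(0,1)$ with $d_I(\zeta_jx,\zeta_jy)\le\eta\, d_I(x,y)$ for all $j$ and all $x,y\in I$. Let $p$ be a fixed point of $\tau$, and for $k\ge0$ let $\pi_kx$ agree with $x$ at the sites $|i|\le k$ and equal $p$ at all other sites. For continuous $\Phi:\Omega\to\mathbb R$ put $$|\Phi|_\infty=\sup_x|\Phi(x)|,\qquad |\Phi|_\beta=\sup_{k\ge 0}\ \sup_{x\ne y}\frac{|\Phi(\pi_kx)-\Phi(\pi_ky)|}{d(x,y)^\beta},\qquad \mathcal C=\{\Phi\in C(\Omega):|\Phi|_\infty+|\Phi|_\beta<\infty\}.$$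 Let $f\in\mathcal C$. For $s:\{-k,\dots,k\}\to\{1,\dots,b\}$ let $(\zeta_s x)_j=\zeta_{s(j)}x_j$ for $|j|\le k$ and $(\zeta_sx)_j=x_j$ otherwise, and let $$P_k\Phi(x)=b^{-(2k+1)}\sum_{s}e^{f(\pi_k\zeta_sx)}\,\Phi(\pi_k\zeta_sx),\qquad P\Phi(x)=\lim_{k\to\infty}P_k\Phi(x).$$ Let $\nu$ be a Borel probability measure on $\Omega$ with $P^*\nu=\lambda\nu$ on $C(\Omega)$, where $\lambda=\int P\mathbf 1\,d\nu$. Let $\Delta_f$ be the set of continuous $\Phi\ge0$ with $\int\Phi\,d\nu=1$ and $\Phi(x)\le \exp\!\big(|f|_\beta\tfrac{\eta^\beta}{1-\eta^\beta}d(x,y)^\beta\big)\Phi(y)$ for all $x,y$, and let $h\in\Delta_f$ satisfy $Ph=\lambda h$. Put $L\Phi=P(h\Phi)/(\lambda h)$. Let $\sigma$ be the shift, $(\sigma x)_i=x_{i+1}$, and let $E:\Omega\to\Omega$ be a bijection for which there is $C_E\in(0,\eta^{-1})$ with $$d(\sigma^nE^{-1}x,\sigma^nE^{-1}y)\le C_E\,d(\sigma^nx,\sigma^ny)\qquad\text{for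 all }n\in\mathbb Z,\ x,y\in\Omega.$$ The coupled transfer operator is $\mathcal L\Phi=(L\Phi)\circ E^{-1}$. **Theorem.** Such $\nu$ and $h$ exist. For any such $\nu$ and $h$ there is a constant $C_6>0$, depending on $d_I,\theta,\beta,\tau,f,\nu,h$ but not on $E$, $C_E$, $\Phi$ or $n$, such that for every $E$ and $C_E$ as above and every $\Phi\in\mathcal C$ one has $\mathcal L\Phi\in\mathcal C$ and, for all $n\ge0$, $$|\mathcal L^n\Phi|_\beta\ \le\ |\Phi|_\beta\,(C_E\eta)^{\beta n}+C_6\,|\Phi|_\infty\,C_E^{\beta}\sum_{i=0}^{\infty}(C_E\eta)^{i\beta}.$$ In particular, for every such $E$ there are $\theta_1\in(0,1)$ and $C_2>0$ such that $|\mathcal L^n\Phi|_\beta\le\theta_1^n|\Phi|_\beta+C_2|\Phi|_\infty$ for all $\Phi\in\mathcal C$ and $n\ge0$. -/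

import Mathlib

open Filter Topology MeasureTheory
open scoped unitInterval ENNReal

noncomputable section

namespace CoupledLattice

/-- The lattice space `Ω = I^ℤ` over the unit interval, with the product topology (which is the
topology of the metric `latDist` below) and the product (Borel) sigma-algebra. -/
abbrev Omega : Type := ℤ → I

/-- `dI` is a metric on the unit interval which induces the usual topology. -/
structure IsIntervalMetric (dI : I → I → ℝ) : Prop where
  eq_zero_iff : ∀ x y, dI x y = 0 ↔ x = y
  symm : ∀ x y, dI x y = dI y x
  triangle : ∀ x y z, dI x z ≤ dI x y + dI y z
  nhds_basis : ∀ x, (𝓝 x).HasBasis (fun ε : ℝ => 0 < ε) (fun ε => {y | dI x y < ε})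

/-- The metric `d(x, y) = sup_k θ^{|k|} d_I(x_k, y_k)` on `Ω`. -/
def latDist (dI : I → I → ℝ) (θ : ℝ) (x y : Omega) : ℝ :=
  ⨆ k : ℤ, θ ^ k.natAbs * dI (x k) (y k)

/-- `τ : I → I` has `b` full branches, and `ζ 0, …, ζ (b-1) : I → I` are its inverse branches:
for each `x` in the interior of `I` the points `ζ_j x` are pairwise distinct and are exactly the
preimages of `x` under `τ`. The map is expanding: each inverse branch contracts `d_I` by the
factor `η` on all of `I`. (So the inverse branches are continuous up to the end points of `I`;
the value of `τ` at an end point of a branch is left free.) -/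
structure IsFullBranchExpanding (dI : I → I → ℝ) (η : ℝ) (τ : I → I) (b : ℕ)
    (ζ : Fin b → I → I) : Prop where
  branches_pos : 0 < b
  preimages : ∀ x : I, 0 < x → x < 1 →
    Set.BijOn (fun j => ζ j x) Set.univ (τ ⁻¹' {x})
  contracts : ∀ (j : Fin b) (x y : I), dI (ζ j x) (ζ j y) ≤ η * dI x y

/-- The finite sub-lattice `Λ_k = {-k, …, k}`. -/
abbrev Lam (k : ℕ) : Finset ℤ := Finset.Icc (-(k : ℤ)) (k : ℤ)

/-- `π_k`: keep the coordinates in `Λ_k`, and put `p` at all other sites. -/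
def proj (p : I) (k : ℕ) (x : Omega) : Omega :=
  fun i => if i ∈ Lam k then x i else p

/-- The sup norm `|Φ|_∞`, as an extended nonnegative real. -/
def supNorm (Φ : Omega → ℝ) : ℝ≥0∞ := ⨆ x, ENNReal.ofReal |Φ x|

/-- The Hölder constant
`|Φ|_β = sup_k sup_{x,y} |Φ(π_k x) - Φ(π_k y)| / d(x, y)^β`, as an extended nonnegative real. -/
def holderConst (dI : I → I → ℝ) (θ β : ℝ) (p : I) (Φ : Omega → ℝ) : ℝ≥0∞ :=
  ⨆ (k : ℕ) (x : Omega) (y : Omega),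
    ENNReal.ofReal (|Φ (proj p k x) - Φ (proj p k y)| / latDist dI θ x y ^ β)

/-- The function space `𝒞`: continuous functions with `|Φ|_∞ + |Φ|_β < ∞`. -/
def MemC (dI : I → I → ℝ) (θ β : ℝ) (p : I) (Φ : Omega → ℝ) : Prop :=
  Continuous Φ ∧ supNorm Φ + holderConst dI θ β p Φ < ⊤

/-- The inverse branch of `τ̄` restricted to `Λ_k` which uses the branch `ζ_{s j}` at the site
`j ∈ Λ_k` and leaves the coordinates outside `Λ_k` unchanged. -/
def latBranch {b : ℕ} (ζ : Fin b → I → I) (k : ℕ) (s : Lam k → Fin b) (x : Omega) : Omega :=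
  fun j => if hj : j ∈ Lam k then ζ (s ⟨j, hj⟩) (x j) else x j

/-- The finite-lattice operator
`P_k Φ(x) = b^{-(2k+1)} ∑_ζ exp(f(π_k ζ_x)) Φ(π_k ζ_x)`. -/
def opPk {b : ℕ} (ζ : Fin b → I → I) (p : I) (f : Omega → ℝ) (k : ℕ) (Φ : Omega → ℝ)
    (x : Omega) : ℝ :=
  1 / (b : ℝ) ^ (2 * k + 1) *
    ∑ s : Lam k → Fin b,
      Real.exp (f (proj p k (latBranch ζ k s x))) * Φ (proj p k (latBranch ζ k s x))

/-- The operator `P`, the pointwise limit of the `P_k`. -/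
def opP {b : ℕ} (ζ : Fin b → I → I) (p : I) (f : Omega → ℝ) (Φ : Omega → ℝ) (x : Omega) : ℝ :=
  limUnder atTop (fun k : ℕ => opPk ζ p f k Φ x)

/-- The number `λ = P^*ν(1)`. -/
def eigval {b : ℕ} (ζ : Fin b → I → I) (p : I) (f : Omega → ℝ) (ν : Measure Omega) : ℝ :=
  ∫ x, opP ζ p f (fun _ => 1) x ∂ν

/-- `P^*ν = λν` with `λ = P^*ν(1)`, as functionals on `C(Ω)`. -/
def IsEigenmeasure {b : ℕ} (ζ : Fin b → I → I) (p : I) (f : Omega → ℝ)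
    (ν : Measure Omega) : Prop :=
  ∀ Φ : Omega → ℝ, Continuous Φ →
    ∫ x, opP ζ p f Φ x ∂ν = eigval ζ p f ν * ∫ x, Φ x ∂ν

/-- `B(z) = exp(|f|_β η^β / (1 - η^β) z^β)`. -/
def distortion (dI : I → I → ℝ) (θ β η : ℝ) (p : I) (f : Omega → ℝ) (z : ℝ) : ℝ :=
  Real.exp ((holderConst dI θ β p f).toReal * (η ^ β / (1 - η ^ β)) * z ^ β)

/-- The set `Δ_f` of nonnegative continuous functions with `ν(Φ) = 1` and
`Φ(x) ≤ B(d(x, y)) Φ(y)` for all `x, y`. -/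
def DeltaSet (dI : I → I → ℝ) (θ β η : ℝ) (p : I) (f : Omega → ℝ) (ν : Measure Omega) :
    Set (Omega → ℝ) :=
  {Φ | Continuous Φ ∧ (∀ x, 0 ≤ Φ x) ∧ ∫ x, Φ x ∂ν = 1 ∧
    ∀ x y, Φ x ≤ distortion dI θ β η p f (latDist dI θ x y) * Φ y}

/-- `h ∈ Δ_f` and `P h = λ h`. -/
def IsEigenfunction (dI : I → I → ℝ) (θ β η : ℝ) {b : ℕ} (ζ : Fin b → I → I) (p : I)
    (f : Omega → ℝ) (ν : Measure Omega) (h : Omega → ℝ) : Prop :=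
  h ∈ DeltaSet dI θ β η p f ν ∧ ∀ x, opP ζ p f h x = eigval ζ p f ν * h x

/-- The normalized transfer operator `L Φ = P(hΦ) / (λ h)`. -/
def opL {b : ℕ} (ζ : Fin b → I → I) (p : I) (f : Omega → ℝ) (ν : Measure Omega)
    (h : Omega → ℝ) (Φ : Omega → ℝ) (x : Omega) : ℝ :=
  opP ζ p f (fun y => h y * Φ y) x / (eigval ζ p f ν * h x)

/-- The shift `(σ x)_i = x_{i+1}`. -/
def shift : Equiv.Perm Omega where
  toFun x := fun i => x (i + 1)
  invFun x := fun i => x (i - 1)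
  left_inv x := by funext i; simp
  right_inv x := by funext i; simp

/-- `E` is an invertible self-map of `Ω` with
`d(σ^n E⁻¹ x, σ^n E⁻¹ y) ≤ C_E d(σ^n x, σ^n y)` for all `n ∈ ℤ`. -/
def IsCoupling (dI : I → I → ℝ) (θ : ℝ) (E : Equiv.Perm Omega) (CE : ℝ) : Prop :=
  ∀ (n : ℤ) (x y : Omega),
    latDist dI θ ((shift ^ n) (E.symm x)) ((shift ^ n) (E.symm y)) ≤
      CE * latDist dI θ ((shift ^ n) x) ((shift ^ n) y)

/-- The coupled transfer operator `ℒ Φ = (L Φ) ∘ E⁻¹`. -/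
def opCoupled {b : ℕ} (ζ : Fin b → I → I) (p : I) (f : Omega → ℝ) (ν : Measure Omega)
    (h : Omega → ℝ) (E : Equiv.Perm Omega) (Φ : Omega → ℝ) : Omega → ℝ :=
  fun x => opL ζ p f ν h Φ (E.symm x)

end CoupledLattice

end

/-! Since `π_k` erases everything outside `Λ_k`, each `P_k` is an integral against one fixed
Bernoulli measure on sequences of branch choices, and dominated convergence gives `PΦ(x) = ∫
exp(f(ζ_ω x)) Φ(ζ_ω x) dω`, where `ζ_ω` contracts `d` by `η` (`opP_eq_transfer`).

Inequality: `Ph = λh` says that `L` averages `Φ ∘ ζ_ω` with weights of total mass one, so `L` does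
not increase the sup norm. Put `c = |f|_β η^β/(1-η^β)`, the solution of `(|f|_β + c) η^β = c`. Then
`log h` is `c`-Hölder and the log weights are `2c`-Hölder, whence `|LΦ|_β ≤ η^β |Φ|_β + 4c |Φ|_∞`
(`abs_opL_sub_le`). Composing with `E⁻¹` costs a factor `C_E^β`, and iterating sums a geometric
series of ratio `(C_E η)^β < 1`.

Existence: by the same equation for `c`, the operator preserves the cone `g x ≤ exp(c d(x,y)^β) g
y`. Hence the functions `P^n 1` have uniformly bounded oscillation and grow like `λ^n` up to a
constant, by Fekete's lemma from both sides. For `Q = λ⁻¹P`, Cesàro means of `Q^n 1` have a uniform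
limit point by Arzelà–Ascoli, a multiple of `h`. Cesàro means of the functionals `g ↦ Q^n g (x₀)`
have a positive invariant limit, which the Riesz theorem turns into `ν`. -/

noncomputable section

namespace CoupledLattice

/-! ### The metric on the lattice and the product topology -/

section Metric

variable {dI : I → I → ℝ}

lemma IsIntervalMetric.self (hd : IsIntervalMetric dI) (x : I) : dI x x = 0 :=
  (hd.eq_zero_iff x x).2 rfl

lemma IsIntervalMetric.nonneg (hd : IsIntervalMetric dI) (x y : I) : 0 ≤ dI x y := by
  have h := hd.triangle x y x
  rw [hd.self, hd.symm y x] at h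
  linarith

/-- Finitely many unit balls cover the compact interval; the sum of the distances from `0` to their
centres replaces the maximum. -/
lemma IsIntervalMetric.exists_bound (hd : IsIntervalMetric dI) :
    ∃ D : ℝ, 0 < D ∧ ∀ x y, dI x y ≤ D := by
  obtain ⟨t, -, ht⟩ := (isCompact_univ (X := I)).elim_nhds_subcover
    (fun x => {y | dI x y < 1}) (fun x _ => (hd.nhds_basis x).mem_of_mem one_pos)
  have key : ∀ y, dI 0 y ≤ ∑ x ∈ t, dI 0 x + 1 := by
    intro y
    obtain ⟨x, hx, hxy⟩ := Set.mem_iUnion₂.1 (ht (Set.mem_univ y))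
    have h1 := hd.triangle 0 x y
    have h2 := Finset.single_le_sum (f := fun x => dI 0 x) (fun i _ => hd.nonneg 0 i) hx
    simp only [Set.mem_ofPred_eq] at hxy h2
    linarith
  have h0 : 0 ≤ ∑ x ∈ t, dI 0 x := Finset.sum_nonneg fun i _ => hd.nonneg 0 i
  refine ⟨2 * (∑ x ∈ t, dI 0 x + 1), by linarith, fun x y => ?_⟩
  have := hd.triangle x 0 y
  rw [hd.symm x 0] at this
  linarith [key x, key y]

variable {θ : ℝ}

lemma bddAbove_latDist (hd : IsIntervalMetric dI) (hθ : θ ∈ Set.Ioo (0 : ℝ) 1) (x y : Omega) :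
    BddAbove (Set.range fun k : ℤ => θ ^ k.natAbs * dI (x k) (y k)) := by
  obtain ⟨D, hD, hb⟩ := hd.exists_bound
  refine ⟨D, ?_⟩
  rintro _ ⟨k, rfl⟩
  have h1 : θ ^ k.natAbs ≤ 1 := pow_le_one₀ hθ.1.le hθ.2.le
  calc θ ^ k.natAbs * dI (x k) (y k) ≤ 1 * D :=
        mul_le_mul h1 (hb _ _) (hd.nonneg _ _) zero_le_one
    _ = D := one_mul D

lemma le_latDist (hd : IsIntervalMetric dI) (hθ : θ ∈ Set.Ioo (0 : ℝ) 1) (x y : Omega) (k : ℤ) :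
    θ ^ k.natAbs * dI (x k) (y k) ≤ latDist dI θ x y :=
  le_ciSup (bddAbove_latDist hd hθ x y) k

lemma latDist_le {x y : Omega} {c : ℝ} (h : ∀ k : ℤ, θ ^ k.natAbs * dI (x k) (y k) ≤ c) :
    latDist dI θ x y ≤ c :=
  ciSup_le h

lemma latDist_nonneg (hd : IsIntervalMetric dI) (hθ : θ ∈ Set.Ioo (0 : ℝ) 1) (x y : Omega) :
    0 ≤ latDist dI θ x y :=
  (mul_nonneg (pow_nonneg hθ.1.le _) (hd.nonneg _ _)).trans (le_latDist hd hθ x y 0)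

lemma latDist_comm (hd : IsIntervalMetric dI) (x y : Omega) :
    latDist dI θ x y = latDist dI θ y x := by
  simp only [latDist, hd.symm]

lemma exists_latDist_bound (hd : IsIntervalMetric dI) (hθ : θ ∈ Set.Ioo (0 : ℝ) 1) :
    ∃ D : ℝ, 0 < D ∧ ∀ x y, latDist dI θ x y ≤ D := by
  obtain ⟨D, hD, hb⟩ := hd.exists_bound
  refine ⟨D, hD, fun x y => latDist_le fun k => ?_⟩
  have h1 : θ ^ k.natAbs ≤ 1 := pow_le_one₀ hθ.1.le hθ.2.le
  calc θ ^ k.natAbs * dI (x k) (y k) ≤ 1 * D :=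
        mul_le_mul h1 (hb _ _) (hd.nonneg _ _) zero_le_one
    _ = D := one_mul D

lemma eq_of_latDist_eq_zero (hd : IsIntervalMetric dI) (hθ : θ ∈ Set.Ioo (0 : ℝ) 1)
    {x y : Omega} (h : latDist dI θ x y = 0) : x = y := by
  funext k
  have h1 := le_latDist hd hθ x y k
  rw [h] at h1
  refine (hd.eq_zero_iff _ _).1 (le_antisymm ?_ (hd.nonneg _ _))
  exact nonpos_of_mul_nonpos_right h1 (pow_pos hθ.1 _)

/-- With `tendsto_of_tendsto_latDist`, this identifies the topology of `d` with the product
topology: finitely many near sites are controlled by coordinatewise convergence, the far ones by the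
weight `θ^|k|` and the boundedness of `d_I`. -/
lemma tendsto_latDist (hd : IsIntervalMetric dI) (hθ : θ ∈ Set.Ioo (0 : ℝ) 1) (x : Omega) :
    Tendsto (fun y => latDist dI θ x y) (𝓝 x) (𝓝 0) := by
  obtain ⟨D, hD, hb⟩ := hd.exists_bound
  refine tendsto_order.2 ⟨fun a ha => Eventually.of_forall fun y =>
    ha.trans_le (latDist_nonneg hd hθ x y), fun ε hε => ?_⟩
  obtain ⟨N, hN⟩ := exists_pow_lt_of_lt_one (show 0 < ε / 2 / D by positivity) hθ.2
  have hfin : ∀ᶠ y in 𝓝 x, ∀ k ∈ Finset.Icc (-(N : ℤ)) N, dI (x k) (y k) < ε / 2 := by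
    rw [Filter.eventually_all_finset]
    intro k _
    exact (continuous_apply k).continuousAt.eventually
      ((hd.nhds_basis (x k)).mem_of_mem (half_pos hε))
  filter_upwards [hfin] with y hy
  refine (latDist_le (c := ε / 2) fun k => ?_).trans_lt (half_lt_self hε)
  by_cases hk : k ∈ Finset.Icc (-(N : ℤ)) N
  · have h1 : θ ^ k.natAbs ≤ 1 := pow_le_one₀ hθ.1.le hθ.2.le
    calc θ ^ k.natAbs * dI (x k) (y k) ≤ 1 * (ε / 2) :=
          mul_le_mul h1 (hy k hk).le (hd.nonneg _ _) zero_le_one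
      _ = ε / 2 := one_mul _
  · have hk' : N ≤ k.natAbs := by
      rw [Finset.mem_Icc] at hk
      omega
    have h1 : θ ^ k.natAbs ≤ ε / 2 / D := (pow_le_pow_of_le_one hθ.1.le hθ.2.le hk').trans hN.le
    calc θ ^ k.natAbs * dI (x k) (y k) ≤ ε / 2 / D * D :=
          mul_le_mul h1 (hb _ _) (hd.nonneg _ _) (by positivity)
      _ = ε / 2 := by field_simp

lemma tendsto_of_tendsto_latDist (hd : IsIntervalMetric dI) (hθ : θ ∈ Set.Ioo (0 : ℝ) 1)
    {α : Type*} {l : Filter α} {x : Omega} {u : α → Omega}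
    (h : Tendsto (fun a => latDist dI θ x (u a)) l (𝓝 0)) : Tendsto u l (𝓝 x) := by
  rw [tendsto_pi_nhds]
  intro k
  rw [(hd.nhds_basis (x k)).tendsto_right_iff]
  intro ε hε
  have hpos : 0 < θ ^ k.natAbs * ε := mul_pos (pow_pos hθ.1 _) hε
  filter_upwards [h.eventually_lt_const hpos] with a ha
  exact lt_of_mul_lt_mul_left ((le_latDist hd hθ x (u a) k).trans_lt ha) (pow_nonneg hθ.1.le _)

lemma continuous_of_latDist_le (hd : IsIntervalMetric dI) (hθ : θ ∈ Set.Ioo (0 : ℝ) 1)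
    {u : Omega → Omega} {c : ℝ} (h : ∀ x y, latDist dI θ (u x) (u y) ≤ c * latDist dI θ x y) :
    Continuous u := by
  rw [continuous_iff_continuousAt]
  intro x
  refine tendsto_of_tendsto_latDist hd hθ ?_
  have h0 : Tendsto (fun y => c * latDist dI θ x y) (𝓝 x) (𝓝 0) := by
    simpa using (tendsto_latDist hd hθ x).const_mul c
  exact squeeze_zero (fun y => latDist_nonneg hd hθ _ _) (fun y => h x y) h0

lemma continuous_of_dI_le (hd : IsIntervalMetric dI) {g : I → I} {c : ℝ}
    (h : ∀ x y, dI (g x) (g y) ≤ c * dI x y) : Continuous g := by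
  rw [continuous_iff_continuousAt]
  intro x
  refine ((hd.nhds_basis x).tendsto_iff (hd.nhds_basis (g x))).2 fun ε hε => ?_
  -- The added `1` keeps the denominator positive, whatever `c` is.
  refine ⟨ε / (|c| + 1), by positivity, fun y hy => ?_⟩
  rw [Set.mem_ofPred_eq, lt_div_iff₀ (by positivity)] at hy
  have h1 : c * dI x y ≤ |c| * dI x y := mul_le_mul_of_nonneg_right (le_abs_self c) (hd.nonneg _ _)
  have h2 := hd.nonneg x y
  have h3 := h x y
  rw [Set.mem_ofPred_eq]
  linarith

lemma tendsto_latDist_rpow (hd : IsIntervalMetric dI) (hθ : θ ∈ Set.Ioo (0 : ℝ) 1) {β : ℝ}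
    (hβ : 0 < β) (x : Omega) : Tendsto (fun y => latDist dI θ x y ^ β) (𝓝 x) (𝓝 0) := by
  simpa [Real.zero_rpow hβ.ne'] using (tendsto_latDist hd hθ x).rpow_const (Or.inr hβ.le)

end Metric

/-! ### Finite projections and the Hölder constant -/

section Proj

variable {p : I}

lemma tendsto_proj (u : ℕ → Omega) (x : Omega)
    (h : ∀ i, ∀ᶠ k in atTop, u k i = x i) :
    Tendsto (fun k => proj p k (u k)) atTop (𝓝 x) := by
  rw [tendsto_pi_nhds]
  intro i
  refine tendsto_const_nhds.congr' ?_
  filter_upwards [h i, eventually_ge_atTop i.natAbs] with k hk hi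
  have : i ∈ Lam k := by
    rw [Finset.mem_Icc]
    omega
  rw [proj, if_pos this, hk]

lemma latDist_proj_le {dI : I → I → ℝ} {θ : ℝ} (hd : IsIntervalMetric dI)
    (hθ : θ ∈ Set.Ioo (0 : ℝ) 1) (k : ℕ) (x y : Omega) :
    latDist dI θ (proj p k x) (proj p k y) ≤ latDist dI θ x y := by
  refine latDist_le fun i => ?_
  by_cases hi : i ∈ Lam k
  · simpa only [proj, if_pos hi] using le_latDist hd hθ x y i
  · simpa only [proj, if_neg hi, hd.self, mul_zero] using latDist_nonneg hd hθ x y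

end Proj

section Norms

variable {dI : I → I → ℝ} {θ β : ℝ} {p : I} {Φ : Omega → ℝ}

lemma holderConst_le (hd : IsIntervalMetric dI) (hθ : θ ∈ Set.Ioo (0 : ℝ) 1) (hβ : 0 < β)
    {c : ℝ} (hc : 0 ≤ c) (h : ∀ x y, |Φ x - Φ y| ≤ c * latDist dI θ x y ^ β) :
    holderConst dI θ β p Φ ≤ ENNReal.ofReal c := by
  refine iSup_le fun k => iSup_le fun x => iSup_le fun y => ENNReal.ofReal_le_ofReal ?_
  -- This form allows a zero denominator, so the pairs `x = y` need no separate treatment.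
  refine div_le_of_le_mul₀ (Real.rpow_nonneg (latDist_nonneg hd hθ x y) _) hc ?_
  refine (h _ _).trans (mul_le_mul_of_nonneg_left ?_ hc)
  exact Real.rpow_le_rpow (latDist_nonneg hd hθ _ _) (latDist_proj_le hd hθ k x y) hβ.le

/-- By continuity the bound at `π_k x`, `π_k y` passes to the limit `k → ∞`. With `holderConst_le`,
this makes `|·|_β` the ordinary Hölder constant on continuous functions, so the projections can be
forgotten afterwards. -/
lemma abs_sub_le_holderConst (hd : IsIntervalMetric dI) (hθ : θ ∈ Set.Ioo (0 : ℝ) 1)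
    (hΦ : Continuous Φ) (hfin : holderConst dI θ β p Φ ≠ ⊤) (x y : Omega) :
    |Φ x - Φ y| ≤ (holderConst dI θ β p Φ).toReal * latDist dI θ x y ^ β := by
  rcases (latDist_nonneg hd hθ x y).eq_or_lt with h0 | h0
  · have : x = y := eq_of_latDist_eq_zero hd hθ h0.symm
    subst this
    rw [sub_self, abs_zero]
    exact mul_nonneg ENNReal.toReal_nonneg (Real.rpow_nonneg (latDist_nonneg hd hθ _ _) _)
  have hlim : ∀ z, Tendsto (fun k => Φ (proj p k z)) atTop (𝓝 (Φ z)) := fun z =>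
    (hΦ.tendsto z).comp (tendsto_proj (fun _ => z) z
      fun _ => Eventually.of_forall fun _ => rfl)
  refine le_of_tendsto ((hlim x).sub (hlim y)).abs (Eventually.of_forall fun k => ?_)
  rw [← div_le_iff₀ (Real.rpow_pos_of_pos h0 _)]
  refine (ENNReal.ofReal_le_iff_le_toReal hfin).1 ?_
  exact le_iSup_of_le k (le_iSup_of_le x (le_iSup_of_le y le_rfl))

lemma supNorm_le {c : ℝ} (h : ∀ x, |Φ x| ≤ c) : supNorm Φ ≤ ENNReal.ofReal c :=
  iSup_le fun x => ENNReal.ofReal_le_ofReal (h x)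

lemma abs_le_supNorm (hfin : supNorm Φ ≠ ⊤) (x : Omega) : |Φ x| ≤ (supNorm Φ).toReal :=
  (ENNReal.ofReal_le_iff_le_toReal hfin).1 (le_iSup (fun x => ENNReal.ofReal |Φ x|) x)

lemma MemC.supNorm_ne_top (h : MemC dI θ β p Φ) : supNorm Φ ≠ ⊤ :=
  (ENNReal.add_lt_top.1 h.2).1.ne

lemma MemC.holderConst_ne_top (h : MemC dI θ β p Φ) : holderConst dI θ β p Φ ≠ ⊤ :=
  (ENNReal.add_lt_top.1 h.2).2.ne

lemma memC_of_bounds (hΦ : Continuous Φ) {s c : ℝ} (hs : supNorm Φ ≤ ENNReal.ofReal s)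
    (hc : holderConst dI θ β p Φ ≤ ENNReal.ofReal c) : MemC dI θ β p Φ :=
  ⟨hΦ, ENNReal.add_lt_top.2 ⟨hs.trans_lt ENNReal.ofReal_lt_top, hc.trans_lt ENNReal.ofReal_lt_top⟩⟩

end Norms

/-! ### The transfer operator as an integral over branch sequences -/

section Branches

variable {b : ℕ}

/-- The inverse branch of the product map which uses the branch `ζ (ω j)` at each site `j`. -/
def fullBranch (ζ : Fin b → I → I) (ω : ℤ → Fin b) (x : Omega) : Omega :=
  fun j => ζ (ω j) (x j)

/-- The Bernoulli measure on `{1, …, b}^ℤ` with equal weights. -/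
def branchMeasure (b : ℕ) : Measure (ℤ → Fin b) :=
  Measure.infinitePi fun _ : ℤ => ProbabilityTheory.uniformOn (Set.univ : Set (Fin b))

instance isProbabilityMeasure_uniformOn_fin [NeZero b] :
    IsProbabilityMeasure (ProbabilityTheory.uniformOn (Set.univ : Set (Fin b))) :=
  ProbabilityTheory.isProbabilityMeasure_uniformOn Set.finite_univ Set.univ_nonempty

instance isProbabilityMeasure_branchMeasure [NeZero b] :
    IsProbabilityMeasure (branchMeasure b) := by
  unfold branchMeasure
  infer_instance

/-- The transfer operator, as an integral over all inverse branches of the product map. -/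
def transfer (ζ : Fin b → I → I) (f Φ : Omega → ℝ) (x : Omega) : ℝ :=
  ∫ ω, Real.exp (f (fullBranch ζ ω x)) * Φ (fullBranch ζ ω x) ∂branchMeasure b

variable {ζ : Fin b → I → I} {f Φ : Omega → ℝ} {p : I}

lemma continuous_fullBranch_right (hζ : ∀ j, Continuous (ζ j)) (ω : ℤ → Fin b) :
    Continuous (fullBranch ζ ω) :=
  continuous_pi fun j => (hζ (ω j)).comp (continuous_apply j)

lemma continuous_fullBranch_left (x : Omega) : Continuous fun ω => fullBranch ζ ω x :=
  continuous_pi fun j => (continuous_of_discreteTopology (f := fun i => ζ i (x j))).comp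
    (continuous_apply j)

lemma continuous_proj (p : I) (k : ℕ) : Continuous (proj p k) := by
  refine continuous_pi fun i => ?_
  by_cases hi : i ∈ Lam k
  · simpa only [proj, if_pos hi] using continuous_apply i
  · simpa only [proj, if_neg hi] using continuous_const

lemma exists_abs_bound {g : Omega → ℝ} (hg : Continuous g) : ∃ c : ℝ, 0 ≤ c ∧ ∀ x, |g x| ≤ c := by
  obtain ⟨c, hc⟩ := isCompact_univ.exists_bound_of_continuousOn hg.continuousOn
  exact ⟨c, (norm_nonneg _).trans (hc 0 trivial), fun x => hc x trivial⟩

lemma pi_uniformOn_real_singleton [NeZero b] (k : ℕ) (s : Lam k → Fin b) :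
    (Measure.pi fun _ : Lam k =>
      ProbabilityTheory.uniformOn (Set.univ : Set (Fin b))).real {s} = 1 / (b : ℝ) ^ (2 * k + 1) := by
  have hcard : Fintype.card (Lam k) = 2 * k + 1 := by
    rw [Fintype.card_coe, Int.card_Icc]
    omega
  rw [Measure.real, Measure.pi_singleton]
  simp only [ProbabilityTheory.uniformOn_univ, Measure.count_singleton, Finset.prod_const,
    Finset.card_univ, hcard, Fintype.card_fin, ENNReal.toReal_pow, ENNReal.toReal_inv,
    ENNReal.toReal_natCast, one_div, inv_pow]

/-- The marginal of the Bernoulli measure on `Λ_k` is uniform, with mass `b^{-(2k+1)}` at each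
point. -/
lemma integral_restrict_branchMeasure [NeZero b] (k : ℕ) (g : (Lam k → Fin b) → ℝ) :
    ∫ ω, g (fun j => ω j) ∂branchMeasure b = 1 / (b : ℝ) ^ (2 * k + 1) * ∑ s, g s := by
  have h := integral_restrict_infinitePi (s := Lam k)
    (μ := fun _ : ℤ => ProbabilityTheory.uniformOn (Set.univ : Set (Fin b))) (f := g)
    (measurable_of_finite g).aestronglyMeasurable
  refine h.trans ?_
  rw [integral_fintype (Integrable.of_finite)]
  simp only [pi_uniformOn_real_singleton, smul_eq_mul, Finset.mul_sum]

/-- After `π_k`, the branch acting only on `Λ_k` and the branch acting at every site coincide. All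
`P_k` thus become integrals against the same measure, and their limit can be taken under the
integral. -/
lemma opPk_eq_integral [NeZero b] (k : ℕ) (x : Omega) :
    opPk ζ p f k Φ x = ∫ ω, Real.exp (f (proj p k (fullBranch ζ ω x))) *
      Φ (proj p k (fullBranch ζ ω x)) ∂branchMeasure b := by
  have key : ∀ ω : ℤ → Fin b, proj p k (latBranch ζ k (fun j => ω j) x) =
      proj p k (fullBranch ζ ω x) := by
    intro ω
    funext i
    by_cases hi : i ∈ Lam k
    · simp only [proj, if_pos hi, latBranch, dif_pos hi, fullBranch]
    · simp only [proj, if_neg hi]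
  have h := integral_restrict_branchMeasure (b := b) k fun s =>
    Real.exp (f (proj p k (latBranch ζ k s x))) * Φ (proj p k (latBranch ζ k s x))
  simp only [key] at h
  exact h.symm

lemma integrable_branch [NeZero b] {g : Omega → ℝ} (hg : Continuous g) (x : Omega) :
    Integrable (fun ω => g (fullBranch ζ ω x)) (branchMeasure b) := by
  obtain ⟨c, -, hc⟩ := exists_abs_bound hg
  exact Integrable.of_bound ((hg.comp (continuous_fullBranch_left x)).aestronglyMeasurable) c
    (Eventually.of_forall fun ω => hc _)

lemma opP_eq_transfer [NeZero b] (hf : Continuous f) (hΦ : Continuous Φ) (x : Omega) :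
    opP ζ p f Φ x = transfer ζ f Φ x := by
  have hg : Continuous fun y => Real.exp (f y) * Φ y := by fun_prop
  obtain ⟨c, -, hc⟩ := exists_abs_bound hg
  refine Tendsto.limUnder_eq ?_
  simp only [opPk_eq_integral]
  refine tendsto_integral_of_dominated_convergence (fun _ => c) (fun k => ?_)
    (integrable_const c) (fun k => Eventually.of_forall fun ω => hc _)
    (Eventually.of_forall fun ω => ?_)
  · exact (hg.comp ((continuous_proj p k).comp
      (continuous_fullBranch_left x))).aestronglyMeasurable
  · exact (hg.tendsto _).comp (tendsto_proj (fun _ => fullBranch ζ ω x) _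
      fun _ => Eventually.of_forall fun _ => rfl)

lemma continuous_transfer [NeZero b] (hζ : ∀ j, Continuous (ζ j)) (hf : Continuous f)
    (hΦ : Continuous Φ) : Continuous (transfer ζ f Φ) := by
  have hg : Continuous fun y => Real.exp (f y) * Φ y := by fun_prop
  obtain ⟨c, -, hc⟩ := exists_abs_bound hg
  exact continuous_of_dominated (bound := fun _ => c)
    (fun x => (hg.comp (continuous_fullBranch_left x)).aestronglyMeasurable)
    (fun x => Eventually.of_forall fun ω => hc _) (integrable_const c)
    (Eventually.of_forall fun _ => hg.comp (continuous_fullBranch_right hζ _))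

lemma integrable_transfer [NeZero b] (hf : Continuous f) (hΦ : Continuous Φ) (x : Omega) :
    Integrable (fun ω => Real.exp (f (fullBranch ζ ω x)) * Φ (fullBranch ζ ω x))
      (branchMeasure b) :=
  integrable_branch (g := fun y => Real.exp (f y) * Φ y) (by fun_prop) x

lemma transfer_mono [NeZero b] {Ψ : Omega → ℝ} (hf : Continuous f) (hΦ : Continuous Φ)
    (hΨ : Continuous Ψ) (h : ∀ x, Φ x ≤ Ψ x) (x : Omega) :
    transfer ζ f Φ x ≤ transfer ζ f Ψ x :=
  integral_mono (integrable_transfer hf hΦ x) (integrable_transfer hf hΨ x)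
    fun _ => mul_le_mul_of_nonneg_left (h _) (Real.exp_pos _).le

lemma transfer_add [NeZero b] {Ψ : Omega → ℝ} (hf : Continuous f) (hΦ : Continuous Φ)
    (hΨ : Continuous Ψ) (x : Omega) :
    transfer ζ f (fun y => Φ y + Ψ y) x = transfer ζ f Φ x + transfer ζ f Ψ x := by
  simp only [transfer, mul_add]
  exact integral_add (integrable_transfer hf hΦ x) (integrable_transfer hf hΨ x)

lemma transfer_const_mul (c : ℝ) (x : Omega) :
    transfer ζ f (fun y => c * Φ y) x = c * transfer ζ f Φ x := by
  simp only [transfer, mul_left_comm _ c]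
  exact integral_const_mul c _

lemma latDist_fullBranch_le {dI : I → I → ℝ} {θ η : ℝ} (hd : IsIntervalMetric dI)
    (hθ : θ ∈ Set.Ioo (0 : ℝ) 1) (hη : 0 ≤ η)
    (hζ : ∀ j x y, dI (ζ j x) (ζ j y) ≤ η * dI x y) (ω : ℤ → Fin b) (x y : Omega) :
    latDist dI θ (fullBranch ζ ω x) (fullBranch ζ ω y) ≤ η * latDist dI θ x y := by
  refine latDist_le fun k => ?_
  calc θ ^ k.natAbs * dI (ζ (ω k) (x k)) (ζ (ω k) (y k))
      ≤ θ ^ k.natAbs * (η * dI (x k) (y k)) :=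
        mul_le_mul_of_nonneg_left (hζ _ _ _) (pow_nonneg hθ.1.le _)
    _ = η * (θ ^ k.natAbs * dI (x k) (y k)) := by ring
    _ ≤ η * latDist dI θ x y := mul_le_mul_of_nonneg_left (le_latDist hd hθ x y k) hη

lemma latDist_fullBranch_rpow_le {dI : I → I → ℝ} {θ η β : ℝ} (hd : IsIntervalMetric dI)
    (hθ : θ ∈ Set.Ioo (0 : ℝ) 1) (hη : 0 ≤ η) (hβ : 0 < β)
    (hζ : ∀ j x y, dI (ζ j x) (ζ j y) ≤ η * dI x y) (ω : ℤ → Fin b) (x y : Omega) :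
    latDist dI θ (fullBranch ζ ω x) (fullBranch ζ ω y) ^ β ≤ η ^ β * latDist dI θ x y ^ β := by
  rw [← Real.mul_rpow hη (latDist_nonneg hd hθ x y)]
  exact Real.rpow_le_rpow (latDist_nonneg hd hθ _ _) (latDist_fullBranch_le hd hθ hη hζ ω x y) hβ.le

end Branches

/-- The bound uses the sum of the two exponentials because each integrates to `1` when they are
Markov weights. -/
lemma abs_exp_sub_exp_le (a b : ℝ) :
    |Real.exp a - Real.exp b| ≤ |a - b| * (Real.exp a + Real.exp b) := by
  have key : ∀ u v : ℝ, Real.exp u - Real.exp v ≤ |u - v| * (Real.exp u + Real.exp v) := by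
    intro u v
    have h1 : Real.exp v = Real.exp u * Real.exp (v - u) := by rw [← Real.exp_add]; ring_nf
    have h2 := Real.add_one_le_exp (v - u)
    have h3 := Real.exp_pos u
    calc Real.exp u - Real.exp v = Real.exp u * (1 - Real.exp (v - u)) := by rw [h1]; ring
      _ ≤ Real.exp u * (u - v) := mul_le_mul_of_nonneg_left (by linarith) h3.le
      _ ≤ Real.exp u * |u - v| := mul_le_mul_of_nonneg_left (le_abs_self _) h3.le
      _ ≤ |u - v| * (Real.exp u + Real.exp v) := by
        nlinarith [mul_nonneg (abs_nonneg (u - v)) (Real.exp_pos v).le]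
  refine abs_sub_le_iff.2 ⟨key a b, ?_⟩
  rw [abs_sub_comm, add_comm]
  exact key b a

/-! ### The Lasota–Yorke inequality -/

section LasotaYorke

variable {dI : I → I → ℝ} {θ β η : ℝ} {b : ℕ} {ζ : Fin b → I → I} {p : I}

/-- Change `Φ` and the weight one at a time. The first change gains `η^β` from the contraction of
the branch; the second costs `K s` for each of the two weights, each of total mass one. -/
lemma abs_integral_markov_sub_le [NeZero b] (hd : IsIntervalMetric dI)
    (hθ : θ ∈ Set.Ioo (0 : ℝ) 1) (hη : 0 ≤ η) (hβ : 0 < β)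
    (hζ : ∀ j x y, dI (ζ j x) (ζ j y) ≤ η * dI x y)
    {W : (ℤ → Fin b) → Omega → ℝ} (hW : ∀ x, Continuous fun ω => W ω x)
    (hW1 : ∀ x, ∫ ω, Real.exp (W ω x) ∂branchMeasure b = 1)
    {K : ℝ} (hK : 0 ≤ K) (hWK : ∀ ω x y, |W ω x - W ω y| ≤ K * latDist dI θ x y ^ β)
    {Φ : Omega → ℝ} (hΦ : Continuous Φ) {a s : ℝ} (ha : 0 ≤ a)
    (hΦa : ∀ x y, |Φ x - Φ y| ≤ a * latDist dI θ x y ^ β) (hΦs : ∀ x, |Φ x| ≤ s)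
    (x y : Omega) :
    |∫ ω, Real.exp (W ω x) * Φ (fullBranch ζ ω x) ∂branchMeasure b -
        ∫ ω, Real.exp (W ω y) * Φ (fullBranch ζ ω y) ∂branchMeasure b| ≤
      (η ^ β * a + 2 * K * s) * latDist dI θ x y ^ β := by
  set D := latDist dI θ x y ^ β
  have hD : 0 ≤ D := Real.rpow_nonneg (latDist_nonneg hd hθ x y) _
  have hs : 0 ≤ s := (abs_nonneg _).trans (hΦs 0)
  have hint : ∀ {g : (ℤ → Fin b) → ℝ}, Continuous g → Integrable g (branchMeasure b) :=
    fun hg => hg.integrable_of_hasCompactSupport (HasCompactSupport.of_compactSpace _)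
  have hc : ∀ z, Continuous fun ω => Real.exp (W ω z) := fun z => (hW z).rexp
  have hcΦ : ∀ z, Continuous fun ω => Real.exp (W ω z) * Φ (fullBranch ζ ω z) := fun z =>
    (hc z).mul (hΦ.comp (continuous_fullBranch_left z))
  rw [← integral_sub (hint (hcΦ x)) (hint (hcΦ y))]
  refine (abs_integral_le_integral_abs).trans ?_
  have hpt : ∀ ω, |Real.exp (W ω x) * Φ (fullBranch ζ ω x) -
      Real.exp (W ω y) * Φ (fullBranch ζ ω y)| ≤
      (η ^ β * a * D + K * s * D) * Real.exp (W ω x) + K * s * D * Real.exp (W ω y) := by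
    intro ω
    have e1 : |Real.exp (W ω x) * (Φ (fullBranch ζ ω x) - Φ (fullBranch ζ ω y))| ≤
        Real.exp (W ω x) * (a * (η ^ β * D)) := by
      rw [abs_mul, Real.abs_exp]
      exact mul_le_mul_of_nonneg_left ((hΦa _ _).trans (mul_le_mul_of_nonneg_left
        (latDist_fullBranch_rpow_le hd hθ hη hβ hζ ω x y) ha)) (Real.exp_pos _).le
    have e2 : |(Real.exp (W ω x) - Real.exp (W ω y)) * Φ (fullBranch ζ ω y)| ≤
        K * D * (Real.exp (W ω x) + Real.exp (W ω y)) * s := by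
      rw [abs_mul]
      refine mul_le_mul ((abs_exp_sub_exp_le _ _).trans ?_) (hΦs _) (abs_nonneg _) (by positivity)
      exact mul_le_mul_of_nonneg_right (hWK ω x y) (by positivity)
    calc _ = |Real.exp (W ω x) * (Φ (fullBranch ζ ω x) - Φ (fullBranch ζ ω y)) +
          (Real.exp (W ω x) - Real.exp (W ω y)) * Φ (fullBranch ζ ω y)| := by ring_nf
      _ ≤ _ := abs_add_le _ _
      _ ≤ _ := add_le_add e1 e2
      _ = _ := by ring
  calc _ ≤ ∫ ω, ((η ^ β * a * D + K * s * D) * Real.exp (W ω x) +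
        K * s * D * Real.exp (W ω y)) ∂branchMeasure b :=
        integral_mono (hint ((hcΦ x).sub (hcΦ y)).abs)
          (hint (((hc x).const_mul _).add ((hc y).const_mul _))) hpt
    _ = (η ^ β * a + 2 * K * s) * D := by
        rw [integral_add ((hint (hc x)).const_mul _) ((hint (hc y)).const_mul _),
          integral_const_mul, integral_const_mul, hW1, hW1]
        ring

variable {f h : Omega → ℝ} {ν : Measure Omega}

/-- The exponent `|f|_β η^β / (1 - η^β)` of the distortion bound. -/
def distortionExponent (dI : I → I → ℝ) (θ β η : ℝ) (p : I) (f : Omega → ℝ) : ℝ :=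
  (holderConst dI θ β p f).toReal * (η ^ β / (1 - η ^ β))

lemma rpow_mem_Ioo (hη : η ∈ Set.Ioo (0 : ℝ) 1) (hβ : 0 < β) : η ^ β ∈ Set.Ioo (0 : ℝ) 1 :=
  ⟨Real.rpow_pos_of_pos hη.1 _, Real.rpow_lt_one hη.1.le hη.2 hβ⟩

lemma distortionExponent_nonneg (hη : η ∈ Set.Ioo (0 : ℝ) 1) (hβ : 0 < β) :
    0 ≤ distortionExponent dI θ β η p f := by
  have := rpow_mem_Ioo hη hβ
  exact mul_nonneg ENNReal.toReal_nonneg (div_nonneg this.1.le (sub_nonneg.2 this.2.le))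

/-- The exponent is the fixed point of `t ↦ (|f|_β + t) η^β`: one application of the operator adds
the variation of `f` and contracts. Both the Hölder bound for the log weights and the invariance of
the cone rest on this. -/
lemma distortionExponent_eq (hη : η ∈ Set.Ioo (0 : ℝ) 1) (hβ : 0 < β) :
    ((holderConst dI θ β p f).toReal + distortionExponent dI θ β η p f) * η ^ β =
      distortionExponent dI θ β η p f := by
  have h1 : 1 - η ^ β ≠ 0 := (sub_pos.2 (rpow_mem_Ioo hη hβ).2).ne'
  rw [distortionExponent]
  field_simp
  ring

/-- By the distortion inequality a single zero would force `h = 0`, contradicting `∫ h dν = 1`. -/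
lemma pos_of_mem_deltaSet (hh : h ∈ DeltaSet dI θ β η p f ν) (x : Omega) : 0 < h x := by
  obtain ⟨-, h0, h1, h2⟩ := hh
  refine (h0 x).lt_of_ne fun hx => ?_
  have : h = 0 := by
    funext y
    have := h2 y x
    rw [← hx, mul_zero] at this
    exact le_antisymm this (h0 y)
  rw [this] at h1
  simp at h1

lemma abs_log_sub_le_of_mem_deltaSet (hd : IsIntervalMetric dI)
    (hh : h ∈ DeltaSet dI θ β η p f ν) (x y : Omega) :
    |Real.log (h x) - Real.log (h y)| ≤
      distortionExponent dI θ β η p f * latDist dI θ x y ^ β := by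
  have key : ∀ x y, Real.log (h x) - Real.log (h y) ≤
      distortionExponent dI θ β η p f * latDist dI θ x y ^ β := by
    intro x y
    have h1 := Real.log_le_log (pos_of_mem_deltaSet hh x) (hh.2.2.2 x y)
    rw [distortion, Real.log_mul (Real.exp_pos _).ne' (pos_of_mem_deltaSet hh y).ne',
      Real.log_exp] at h1
    rw [distortionExponent]
    linarith
  refine abs_sub_le_iff.2 ⟨key x y, ?_⟩
  rw [latDist_comm hd]
  exact key y x

lemma transfer_one_pos [NeZero b] (hf : Continuous f) (x : Omega) :
    0 < transfer ζ f (fun _ => 1) x := by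
  obtain ⟨c, -, hc⟩ := exists_abs_bound hf
  have h1 : Real.exp (-c) ≤ transfer ζ f (fun _ => 1) x := by
    calc Real.exp (-c) = ∫ _, Real.exp (-c) ∂branchMeasure b := by simp
      _ ≤ _ := integral_mono (integrable_const _)
          (integrable_transfer hf continuous_const x) fun ω => by
            simpa using (abs_le.1 (hc _)).1
  exact (Real.exp_pos _).trans_le h1

lemma eigval_pos [NeZero b] [IsProbabilityMeasure ν] (hζ : ∀ j, Continuous (ζ j))
    (hf : Continuous f) : 0 < eigval ζ p f ν := by
  have hc := continuous_transfer hζ hf (continuous_const (y := (1 : ℝ)))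
  simp only [eigval, opP_eq_transfer hf continuous_const]
  rw [integral_pos_iff_support_of_nonneg (fun x => (transfer_one_pos hf x).le)
    (hc.integrable_of_hasCompactSupport (HasCompactSupport.of_compactSpace _))]
  rw [Function.support_eq_univ fun x => (transfer_one_pos hf x).ne']
  simp

/-- The logarithm of the weight of the branch `ω` in the normalized transfer operator. -/
def logWeight (ζ : Fin b → I → I) (f h : Omega → ℝ) (lam : ℝ) (ω : ℤ → Fin b) (x : Omega) : ℝ :=
  f (fullBranch ζ ω x) + Real.log (h (fullBranch ζ ω x)) - Real.log lam - Real.log (h x)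

lemma exp_logWeight {lam : ℝ} (hl : 0 < lam) (hh : ∀ x, 0 < h x) (ω : ℤ → Fin b) (x : Omega) :
    Real.exp (logWeight ζ f h lam ω x) =
      Real.exp (f (fullBranch ζ ω x)) * h (fullBranch ζ ω x) / (lam * h x) := by
  rw [logWeight, Real.exp_sub, Real.exp_sub, Real.exp_add, Real.exp_log hl, Real.exp_log (hh _),
    Real.exp_log (hh _), div_div]

lemma transfer_mul_div_eq {lam : ℝ} (hl : 0 < lam) (hh : ∀ x, 0 < h x) (Φ : Omega → ℝ)
    (x : Omega) : transfer ζ f (fun y => h y * Φ y) x / (lam * h x) =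
      ∫ ω, Real.exp (logWeight ζ f h lam ω x) * Φ (fullBranch ζ ω x) ∂branchMeasure b := by
  rw [transfer, ← integral_div]
  refine integral_congr_ae (Eventually.of_forall fun ω => ?_)
  simp only [exp_logWeight hl hh]
  ring

lemma continuous_logWeight (hf : Continuous f) (hhc : Continuous h) (hh : ∀ x, 0 < h x)
    (lam : ℝ) (x : Omega) : Continuous fun ω : ℤ → Fin b => logWeight ζ f h lam ω x := by
  have h1 := continuous_fullBranch_left (ζ := ζ) x
  exact (((hf.comp h1).add ((hhc.comp h1).log fun ω => (hh _).ne')).sub continuous_const).sub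
    continuous_const

variable [NeZero b] [IsProbabilityMeasure ν]

lemma opL_eq_integral (hζ : ∀ j, Continuous (ζ j)) (hf : Continuous f)
    (hh : h ∈ DeltaSet dI θ β η p f ν) {Φ : Omega → ℝ} (hΦ : Continuous Φ) (x : Omega) :
    opL ζ p f ν h Φ x = ∫ ω, Real.exp (logWeight ζ f h (eigval ζ p f ν) ω x) *
      Φ (fullBranch ζ ω x) ∂branchMeasure b := by
  rw [opL, opP_eq_transfer hf (hh.1.fun_mul hΦ),
    transfer_mul_div_eq (eigval_pos hζ hf) (pos_of_mem_deltaSet hh)]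

lemma continuous_opL (hζ : ∀ j, Continuous (ζ j)) (hf : Continuous f)
    (hh : h ∈ DeltaSet dI θ β η p f ν) {Φ : Omega → ℝ} (hΦ : Continuous Φ) :
    Continuous (opL ζ p f ν h Φ) := by
  have h1 : opL ζ p f ν h Φ = fun x => transfer ζ f (fun y => h y * Φ y) x /
      (eigval ζ p f ν * h x) := by
    funext x
    rw [opL, opP_eq_transfer hf (hh.1.fun_mul hΦ)]
  rw [h1]
  exact (continuous_transfer hζ hf (hh.1.mul hΦ)).div (continuous_const.mul hh.1)
    fun x => (mul_pos (eigval_pos hζ hf) (pos_of_mem_deltaSet hh x)).ne'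

/-- This is `Ph = λh` divided by `λh`: the normalized operator is Markov. -/
lemma integral_exp_logWeight (hζ : ∀ j, Continuous (ζ j)) (hf : Continuous f)
    (hh : IsEigenfunction dI θ β η ζ p f ν h) (x : Omega) :
    ∫ ω, Real.exp (logWeight ζ f h (eigval ζ p f ν) ω x) ∂branchMeasure b = 1 := by
  have hl := eigval_pos (p := p) (ν := ν) hζ hf
  have hp := pos_of_mem_deltaSet hh.1
  have h1 := transfer_mul_div_eq (ζ := ζ) (f := f) hl hp (fun _ => 1) x
  have h2 := hh.2 x
  rw [opP_eq_transfer hf hh.1.1] at h2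
  simp only [mul_one] at h1
  rw [← h1, h2, div_self (mul_pos hl (hp x)).ne']

lemma abs_opL_le (hζ : ∀ j, Continuous (ζ j)) (hf : Continuous f)
    (hh : IsEigenfunction dI θ β η ζ p f ν h) {Φ : Omega → ℝ} (hΦ : Continuous Φ) {s : ℝ}
    (hs : ∀ x, |Φ x| ≤ s) (x : Omega) : |opL ζ p f ν h Φ x| ≤ s := by
  have hc := (continuous_logWeight (ζ := ζ) hf hh.1.1 (pos_of_mem_deltaSet hh.1)
    (eigval ζ p f ν) x).rexp
  have hint : ∀ {g : (ℤ → Fin b) → ℝ}, Continuous g → Integrable g (branchMeasure b) :=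
    fun hg => hg.integrable_of_hasCompactSupport (HasCompactSupport.of_compactSpace _)
  rw [opL_eq_integral hζ hf hh.1 hΦ]
  refine abs_integral_le_integral_abs.trans ?_
  calc _ ≤ ∫ ω, Real.exp (logWeight ζ f h (eigval ζ p f ν) ω x) * s ∂branchMeasure b :=
        integral_mono (hint (hc.mul (hΦ.comp (continuous_fullBranch_left x))).abs)
          (hint (hc.mul_const _)) fun ω => by
            rw [Pi.mul_apply, abs_mul, Real.abs_exp]
            exact mul_le_mul_of_nonneg_left (hs _) (Real.exp_pos _).le
    _ = s := by rw [integral_mul_const, integral_exp_logWeight hζ hf hh, one_mul]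

/-- With `c` the distortion exponent, `f` and `log h` along the branch contribute `(|f|_β + c) η^β =
c` to the Hölder constant of the log weight, and `log h` at the base point contributes another `c`.
So `K = 2c`. -/
lemma abs_opL_sub_le (hd : IsIntervalMetric dI) (hθ : θ ∈ Set.Ioo (0 : ℝ) 1)
    (hη : η ∈ Set.Ioo (0 : ℝ) 1) (hβ : 0 < β)
    (hζ : ∀ j x y, dI (ζ j x) (ζ j y) ≤ η * dI x y) (hf : MemC dI θ β p f)
    (hh : IsEigenfunction dI θ β η ζ p f ν h) {Φ : Omega → ℝ} (hΦ : Continuous Φ) {a s : ℝ}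
    (ha : 0 ≤ a) (hΦa : ∀ x y, |Φ x - Φ y| ≤ a * latDist dI θ x y ^ β) (hs : ∀ x, |Φ x| ≤ s)
    (x y : Omega) :
    |opL ζ p f ν h Φ x - opL ζ p f ν h Φ y| ≤
      (η ^ β * a + 2 * (2 * distortionExponent dI θ β η p f) * s) * latDist dI θ x y ^ β := by
  have hζc : ∀ j, Continuous (ζ j) := fun j => continuous_of_dI_le hd (hζ j)
  rw [opL_eq_integral hζc hf.1 hh.1 hΦ, opL_eq_integral hζc hf.1 hh.1 hΦ]
  have hexp := distortionExponent_nonneg (dI := dI) (θ := θ) (p := p) (f := f) hη hβ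
  refine abs_integral_markov_sub_le hd hθ hη.1.le hβ hζ
    (continuous_logWeight hf.1 hh.1.1 (pos_of_mem_deltaSet hh.1) _)
    (integral_exp_logWeight hζc hf.1 hh) (by linarith) (fun ω x y => ?_) hΦ ha hΦa hs x y
  set D := latDist dI θ x y ^ β with hD
  have h1 := latDist_fullBranch_rpow_le hd hθ hη.1.le hβ hζ ω x y
  have h2 := (abs_sub_le_holderConst hd hθ hf.1 hf.holderConst_ne_top (fullBranch ζ ω x)
    (fullBranch ζ ω y)).trans (mul_le_mul_of_nonneg_left h1 ENNReal.toReal_nonneg)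
  have h3 := (abs_log_sub_le_of_mem_deltaSet hd hh.1 (fullBranch ζ ω x)
    (fullBranch ζ ω y)).trans (mul_le_mul_of_nonneg_left h1 hexp)
  have h4 := abs_log_sub_le_of_mem_deltaSet hd hh.1 x y
  have h5 : (holderConst dI θ β p f).toReal * (η ^ β * D) +
      distortionExponent dI θ β η p f * (η ^ β * D) = distortionExponent dI θ β η p f * D := by
    rw [← add_mul, ← mul_assoc, distortionExponent_eq hη hβ]
  rw [← hD] at h2 h3 h4
  simp only [logWeight]
  rw [abs_le] at h2 h3 h4 ⊢
  constructor <;> linarith [h2.1, h2.2, h3.1, h3.2, h4.1, h4.2]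

variable {E : Equiv.Perm Omega} {CE : ℝ}

lemma IsCoupling.latDist_symm_le (hE : IsCoupling dI θ E CE) (x y : Omega) :
    latDist dI θ (E.symm x) (E.symm y) ≤ CE * latDist dI θ x y := by
  simpa using hE 0 x y

lemma opCoupled_bounds (hd : IsIntervalMetric dI) (hθ : θ ∈ Set.Ioo (0 : ℝ) 1)
    (hη : η ∈ Set.Ioo (0 : ℝ) 1) (hβ : 0 < β)
    (hζ : ∀ j x y, dI (ζ j x) (ζ j y) ≤ η * dI x y) (hf : MemC dI θ β p f)
    (hh : IsEigenfunction dI θ β η ζ p f ν h) (hCE : 0 < CE) (hE : IsCoupling dI θ E CE)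
    {Φ : Omega → ℝ} (hΦ : Continuous Φ) {a s : ℝ} (ha : 0 ≤ a)
    (hΦa : ∀ x y, |Φ x - Φ y| ≤ a * latDist dI θ x y ^ β) (hs : ∀ x, |Φ x| ≤ s) :
    Continuous (opCoupled ζ p f ν h E Φ) ∧ (∀ x, |opCoupled ζ p f ν h E Φ x| ≤ s) ∧
      ∀ x y, |opCoupled ζ p f ν h E Φ x - opCoupled ζ p f ν h E Φ y| ≤
        ((CE * η) ^ β * a + (4 * distortionExponent dI θ β η p f) * CE ^ β * s) *
          latDist dI θ x y ^ β := by
  have hζc : ∀ j, Continuous (ζ j) := fun j => continuous_of_dI_le hd (hζ j)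
  refine ⟨(continuous_opL hζc hf.1 hh.1 hΦ).comp
    (continuous_of_latDist_le hd hθ hE.latDist_symm_le),
    fun x => abs_opL_le hζc hf.1 hh hΦ hs _, fun x y => ?_⟩
  have hexp := distortionExponent_nonneg (dI := dI) (θ := θ) (p := p) (f := f) hη hβ
  have hs0 : 0 ≤ s := (abs_nonneg _).trans (hs 0)
  have hηβ := (rpow_mem_Ioo hη hβ).1.le
  refine (abs_opL_sub_le hd hθ hη hβ hζ hf hh hΦ ha hΦa hs _ _).trans ?_
  have h1 : latDist dI θ (E.symm x) (E.symm y) ^ β ≤ CE ^ β * latDist dI θ x y ^ β := by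
    rw [← Real.mul_rpow hCE.le (latDist_nonneg hd hθ x y)]
    exact Real.rpow_le_rpow (latDist_nonneg hd hθ _ _) (hE.latDist_symm_le x y) hβ.le
  refine (mul_le_mul_of_nonneg_left h1 (by positivity)).trans (le_of_eq ?_)
  rw [Real.mul_rpow hCE.le hη.1.le]
  ring

/-- The sup bound is carried through the induction because every step adds a term proportional to
it; as it stays at `s`, the Hölder constants obey an affine recursion, solved by a geometric sum. -/
lemma opCoupled_iterate_bounds (hd : IsIntervalMetric dI) (hθ : θ ∈ Set.Ioo (0 : ℝ) 1)
    (hη : η ∈ Set.Ioo (0 : ℝ) 1) (hβ : 0 < β)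
    (hζ : ∀ j x y, dI (ζ j x) (ζ j y) ≤ η * dI x y) (hf : MemC dI θ β p f)
    (hh : IsEigenfunction dI θ β η ζ p f ν h) (hCE : 0 < CE) (hE : IsCoupling dI θ E CE)
    {Φ : Omega → ℝ} (hΦ : Continuous Φ) {a s : ℝ} (ha : 0 ≤ a)
    (hΦa : ∀ x y, |Φ x - Φ y| ≤ a * latDist dI θ x y ^ β) (hs : ∀ x, |Φ x| ≤ s) (n : ℕ) :
    Continuous ((opCoupled ζ p f ν h E)^[n] Φ) ∧
      (∀ x, |(opCoupled ζ p f ν h E)^[n] Φ x| ≤ s) ∧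
      ∀ x y, |(opCoupled ζ p f ν h E)^[n] Φ x - (opCoupled ζ p f ν h E)^[n] Φ y| ≤
        (((CE * η) ^ β) ^ n * a + (4 * distortionExponent dI θ β η p f) * CE ^ β * s *
          ∑ i ∈ Finset.range n, ((CE * η) ^ β) ^ i) * latDist dI θ x y ^ β := by
  have hexp := distortionExponent_nonneg (dI := dI) (θ := θ) (p := p) (f := f) hη hβ
  have hs0 : 0 ≤ s := (abs_nonneg _).trans (hs 0)
  have hη0 := hη.1
  induction n with
  | zero => simpa using ⟨hΦ, hs, hΦa⟩
  | succ n ih =>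
    obtain ⟨i1, i2, i3⟩ := ih
    obtain ⟨j1, j2, j3⟩ := opCoupled_bounds hd hθ hη hβ hζ hf hh hCE hE i1 (by positivity) i3 i2
    rw [Function.iterate_succ_apply']
    refine ⟨j1, j2, fun x y => (j3 x y).trans (le_of_eq ?_)⟩
    rw [geom_sum_succ]
    ring

end LasotaYorke

/-- Fekete's lemma applies to `log a` and to `log K - log a`. Their limits are opposite, and each
limit is a lower bound for its quotients, which gives the two inequalities. -/
lemma exists_growth_rate {a : ℕ → ℝ} {K : ℝ} (ha : ∀ n, 0 < a n)
    (hsub : ∀ m n, a (m + n) ≤ a m * a n) (hsup : ∀ m n, a m * a n ≤ K * a (m + n)) :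
    ∃ lam : ℝ, 0 < lam ∧ ∀ n, lam ^ n ≤ a n ∧ a n ≤ K * lam ^ n := by
  have hK : 0 < K := by
    have := (mul_pos (ha 0) (ha 0)).trans_le (hsup 0 0)
    exact pos_of_mul_pos_left this (ha _).le
  set u : ℕ → ℝ := fun n => Real.log (a n) with hu
  set v : ℕ → ℝ := fun n => Real.log K - u n with hv
  have hus : Subadditive u := fun m n => by
    rw [hu, ← Real.log_mul (ha m).ne' (ha n).ne']
    exact Real.log_le_log (ha _) (hsub m n)
  have hvs : Subadditive v := fun m n => by
    have h1 := Real.log_le_log (mul_pos (ha m) (ha n)) (hsup m n)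
    rw [Real.log_mul (ha m).ne' (ha n).ne', Real.log_mul hK.ne' (ha _).ne'] at h1
    simp only [hv, hu]
    linarith
  have hu0 : 0 ≤ u 0 := by have := hus 0 0; simp only [add_zero] at this; linarith
  have hv0 : 0 ≤ v 0 := by have := hvs 0 0; simp only [add_zero] at this; linarith
  have hbound : ∀ {w z : ℕ → ℝ}, Subadditive z → (∀ n, z 0 ≤ w n + z n) →
      BddBelow (Set.range fun n => w n / n) := by
    intro w z hz hwz
    -- The quotient at `n = 0` is `0` by convention; for `n > 0`, `z n ≤ n * z 1 + z 0` gives the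
    -- bound `-z 1`.
    refine ⟨min 0 (-z 1), ?_⟩
    rintro _ ⟨n, rfl⟩
    rcases n.eq_zero_or_pos with rfl | hn
    · simp
    · refine (min_le_right _ _).trans ?_
      have hn' : (0 : ℝ) < n := by exact_mod_cast hn
      rw [le_div_iff₀ hn']
      have h1 := hz.apply_mul_add_le n 1 0
      rw [mul_one, add_zero] at h1
      linarith [hwz n]
  have hub : BddBelow (Set.range fun n => u n / n) :=
    hbound hvs fun n => by simp only [hv]; linarith
  have hvb : BddBelow (Set.range fun n => v n / n) :=
    hbound hus fun n => by simp only [hv] at hv0 ⊢; linarith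
  have hlim : hvs.lim = -hus.lim := by
    refine tendsto_nhds_unique (hvs.tendsto_lim hvb) ?_
    have h1 : Tendsto (fun n : ℕ => Real.log K / n) atTop (𝓝 0) :=
      tendsto_const_div_atTop_nhds_zero_nat _
    have h2 := h1.sub (hus.tendsto_lim hub)
    rw [zero_sub] at h2
    exact h2.congr fun n => (sub_div _ _ _).symm
  refine ⟨Real.exp hus.lim, Real.exp_pos _, fun n => ?_⟩
  rw [← Real.exp_nat_mul]
  have h1 : n * hus.lim ≤ u n ∧ u n ≤ Real.log K + n * hus.lim := by
    rcases n.eq_zero_or_pos with rfl | hn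
    · simp only [Nat.cast_zero, zero_mul, add_zero]
      exact ⟨hu0, by simpa [hv] using hv0⟩
    · have hn' : (0 : ℝ) < n := by exact_mod_cast hn
      have h2 := hus.lim_le_div hub hn.ne'
      have h3 := hvs.lim_le_div hvb hn.ne'
      rw [le_div_iff₀ hn'] at h2 h3
      rw [hlim] at h3
      simp only [hv] at h3
      constructor <;> linarith
  constructor
  · rw [← Real.exp_log (ha n)]
    exact Real.exp_le_exp.2 h1.1
  · rw [← Real.exp_log (ha n)]
    nth_rw 1 [← Real.exp_log hK]
    rw [← Real.exp_add]
    exact Real.exp_le_exp.2 h1.2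

/-! ### Fixed functions and invariant measures of positive operators -/

section PositiveOperator

variable {X : Type*} [TopologicalSpace X] [CompactSpace X]

lemma monotone_pow {T : C(X, ℝ) →L[ℝ] C(X, ℝ)} (hT : Monotone T) (n : ℕ) :
    Monotone (T ^ n : C(X, ℝ) →L[ℝ] C(X, ℝ)) := by
  induction n with
  | zero => exact fun _ _ h => h
  | succ n ih =>
    intro g g' h
    rw [pow_succ]
    exact ih (hT h)

lemma abs_apply_le_of_monotone {T : C(X, ℝ) →L[ℝ] C(X, ℝ)} (hT : Monotone T) (g : C(X, ℝ))
    (x : X) : |T g x| ≤ ‖g‖ * T 1 x := by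
  have h1 : g ≤ ‖g‖ • (1 : C(X, ℝ)) := fun y => by
    simpa using (le_abs_self _).trans (g.norm_coe_le_norm y)
  have h2 : -(‖g‖ • (1 : C(X, ℝ))) ≤ g := fun y => by
    simpa using (abs_le.1 (g.norm_coe_le_norm y)).1
  have h3 := hT h1 x
  have h4 := hT h2 x
  rw [map_smul] at h3
  rw [map_neg, map_smul] at h4
  exact abs_le.2 ⟨h4, h3⟩

/-- Positivity makes `‖T^n 1‖` submultiplicative. Bounded oscillation makes every value of `T^n 1`
comparable to that norm, so it is also supermultiplicative up to `K`. -/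
lemma exists_growth_rate_of_monotone [Nonempty X] {T : C(X, ℝ) →L[ℝ] C(X, ℝ)}
    (hT : Monotone T) {K : ℝ} (hpos : ∀ n x, 0 < (T ^ n) 1 x)
    (hK : ∀ n x y, (T ^ n) 1 x ≤ K * (T ^ n) 1 y) :
    ∃ lam : ℝ, 0 < lam ∧ ∀ n x, K⁻¹ * lam ^ n ≤ (T ^ n) 1 x ∧ (T ^ n) 1 x ≤ K * lam ^ n := by
  obtain ⟨x₀⟩ := ‹Nonempty X›
  have hK0 : 0 < K := pos_of_mul_pos_left ((hpos 0 x₀).trans_le (hK 0 x₀ x₀)) (hpos 0 x₀).le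
  have hle : ∀ n x, (T ^ n) 1 x ≤ ‖(T ^ n) 1‖ := fun n x =>
    (le_abs_self _).trans (((T ^ n) 1).norm_coe_le_norm x)
  have hge : ∀ n x, ‖(T ^ n) 1‖ ≤ K * (T ^ n) 1 x := fun n x => by
    refine (ContinuousMap.norm_le _ (mul_pos hK0 (hpos n x)).le).2 fun y => ?_
    rw [Real.norm_of_nonneg (hpos n y).le]
    exact hK n y x
  have hnpos : ∀ n, 0 < ‖(T ^ n) 1‖ := fun n => (hpos n x₀).trans_le (hle n x₀)
  have hadd : ∀ m n, (T ^ (m + n)) 1 = (T ^ m) ((T ^ n) 1) := fun m n => by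
    rw [pow_add]; rfl
  obtain ⟨lam, hl, h⟩ := exists_growth_rate (a := fun n => ‖(T ^ n) 1‖) (K := K) hnpos
    (fun m n => by
      rw [hadd]
      refine (ContinuousMap.norm_le _ (mul_pos (hnpos m) (hnpos n)).le).2 fun x => ?_
      refine (abs_apply_le_of_monotone (monotone_pow hT m) _ x).trans ?_
      rw [mul_comm]
      exact mul_le_mul_of_nonneg_right (hle m x) (hnpos n).le)
    (fun m n => by
      have h1 : ∀ x, ‖(T ^ n) 1‖ * (T ^ m) 1 x ≤ K * (T ^ (m + n)) 1 x := fun x => by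
        have h2 : ‖(T ^ n) 1‖ • (1 : C(X, ℝ)) ≤ K • (T ^ n) 1 := fun y => by
          simpa using hge n y
        have h3 := monotone_pow hT m h2 x
        rw [map_smul, map_smul, ← hadd] at h3
        exact h3
      rw [mul_comm, ← le_div_iff₀' (hnpos n)]
      have hr : 0 ≤ K * ‖(T ^ (m + n)) 1‖ / ‖(T ^ n) 1‖ :=
        div_nonneg (mul_pos hK0 (hnpos _)).le (hnpos n).le
      refine (ContinuousMap.norm_le _ hr).2 fun x => ?_
      rw [Real.norm_of_nonneg (hpos m x).le, le_div_iff₀' (hnpos n)]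
      exact (h1 x).trans (mul_le_mul_of_nonneg_left (hle _ x) hK0.le))
  refine ⟨lam, hl, fun n x => ⟨?_, (hle n x).trans (h n).2⟩⟩
  rw [inv_mul_le_iff₀ hK0]
  exact (h n).1.trans (hge n x)

/-- The Cesàro means of the powers of an operator. -/
def cesaro (Q : C(X, ℝ) →L[ℝ] C(X, ℝ)) (n : ℕ) : C(X, ℝ) →L[ℝ] C(X, ℝ) :=
  ((n : ℝ) + 1)⁻¹ • ∑ i ∈ Finset.range (n + 1), Q ^ i

variable {Q : C(X, ℝ) →L[ℝ] C(X, ℝ)} {K : ℝ}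

lemma apply_cesaro_sub (n : ℕ) (g : C(X, ℝ)) :
    Q (cesaro Q n g) - cesaro Q n g = ((n : ℝ) + 1)⁻¹ • ((Q ^ (n + 1)) g - g) := by
  have h := congrArg (fun A : C(X, ℝ) →L[ℝ] C(X, ℝ) => ((n : ℝ) + 1)⁻¹ • A g)
    (mul_geom_sum Q (n + 1))
  simpa [cesaro, smul_sub] using h

lemma cesaro_apply_sub (n : ℕ) (g : C(X, ℝ)) :
    cesaro Q n (Q g) - cesaro Q n g = ((n : ℝ) + 1)⁻¹ • ((Q ^ (n + 1)) g - g) := by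
  have h := congrArg (fun A : C(X, ℝ) →L[ℝ] C(X, ℝ) => ((n : ℝ) + 1)⁻¹ • A g)
    (geom_sum_mul Q (n + 1))
  simpa [cesaro, smul_sub] using h

lemma norm_pow_apply_le (hQ : Monotone Q) (hK0 : 0 ≤ K) (hK : ∀ n x, (Q ^ n) 1 x ≤ K) (n : ℕ)
    (g : C(X, ℝ)) : ‖(Q ^ n) g‖ ≤ K * ‖g‖ := by
  refine (ContinuousMap.norm_le _ (by positivity)).2 fun x => ?_
  refine (abs_apply_le_of_monotone (monotone_pow hQ n) g x).trans ?_
  rw [mul_comm]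
  exact mul_le_mul_of_nonneg_right (hK n x) (norm_nonneg g)

lemma tendsto_cesaro_remainder (hQ : Monotone Q) (hK0 : 0 ≤ K) (hK : ∀ n x, (Q ^ n) 1 x ≤ K)
    (g : C(X, ℝ)) :
    Tendsto (fun n : ℕ => ((n : ℝ) + 1)⁻¹ • ((Q ^ (n + 1)) g - g)) atTop (𝓝 0) := by
  have h0 : Tendsto (fun n : ℕ => ((n : ℝ) + 1)⁻¹ * (K * ‖g‖ + ‖g‖)) atTop (𝓝 0) := by
    simpa [one_div] using
      (tendsto_one_div_add_atTop_nhds_zero_nat (𝕜 := ℝ)).mul_const (K * ‖g‖ + ‖g‖)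
  refine squeeze_zero_norm (fun n => ?_) h0
  rw [norm_smul, Real.norm_of_nonneg (by positivity)]
  refine mul_le_mul_of_nonneg_left ?_ (by positivity)
  exact (norm_sub_le _ _).trans (add_le_add_left (norm_pow_apply_le hQ hK0 hK _ g) _)

lemma cesaro_apply (n : ℕ) (g : C(X, ℝ)) (x : X) :
    cesaro Q n g x = ((n : ℝ) + 1)⁻¹ * ∑ i ∈ Finset.range (n + 1), (Q ^ i) g x := by
  simp [cesaro]

lemma cesaro_mem {P : Set ℝ} (hP : Convex ℝ P) (n : ℕ) (g : C(X, ℝ)) (x : X)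
    (h : ∀ i, (Q ^ i) g x ∈ P) : cesaro Q n g x ∈ P := by
  rw [cesaro_apply, Finset.mul_sum]
  refine hP.sum_mem (fun i _ => by positivity) ?_ fun i _ => h i
  simp only [Finset.sum_const, Finset.card_range, nsmul_eq_mul]
  push_cast
  exact mul_inv_cancel₀ (by positivity)

/-- Telescoping makes `Q - 1` applied to the Cesàro means of `1` tend to zero, so any limit point is
fixed. -/
theorem exists_fixed_function (hQ : Monotone Q) (hK0 : 0 ≤ K) (hK : ∀ n x, (Q ^ n) 1 x ≤ K)
    {S : Set C(X, ℝ)} (hS : IsCompact S) (hSn : ∀ n, cesaro Q n 1 ∈ S) : ∃ g ∈ S, Q g = g := by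
  obtain ⟨g, hg, φ, hφ, hlim⟩ := hS.tendsto_subseq hSn
  refine ⟨g, hg, ?_⟩
  have h1 : Tendsto (fun n => Q (cesaro Q (φ n) 1) - cesaro Q (φ n) 1) atTop (𝓝 (Q g - g)) :=
    ((Q.continuous.tendsto g).comp hlim).sub hlim
  simp only [apply_cesaro_sub] at h1
  exact sub_eq_zero.1 (tendsto_nhds_unique h1
    ((tendsto_cesaro_remainder hQ hK0 hK 1).comp hφ.tendsto_atTop))

/-- Cesàro means of the functionals `g ↦ Q^n g (x₀)` have an invariant positive limit, represented
by a measure; the lower bound `k` keeps its mass from vanishing, so it can be normalized. -/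
theorem exists_invariant_measure [Nonempty X] [T2Space X] [MeasurableSpace X] [BorelSpace X]
    (hQ : Monotone Q) {k : ℝ} (hk0 : 0 < k) (hk : ∀ n x, k ≤ (Q ^ n) 1 x)
    (hK0 : 0 ≤ K) (hK : ∀ n x, (Q ^ n) 1 x ≤ K) :
    ∃ ν : Measure X, IsProbabilityMeasure ν ∧
      ∀ g : C(X, ℝ), ∫ x, Q g x ∂ν = ∫ x, g x ∂ν := by
  obtain ⟨x₀⟩ := ‹Nonempty X›
  -- Along a nonprincipal ultrafilter the bounded means converge for all `g` at once, so linearity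
  -- and positivity of the limit are immediate.
  have hF : (hyperfilter ℕ : Filter ℕ) ≤ atTop := Nat.hyperfilter_le_atTop
  have hbd : ∀ n g, cesaro Q n g x₀ ∈ Set.Icc (-(K * ‖g‖)) (K * ‖g‖) := fun n g =>
    cesaro_mem (convex_Icc _ _) n g x₀ fun i =>
      abs_le.1 (((Q ^ i) g).norm_coe_le_norm x₀ |>.trans (norm_pow_apply_le hQ hK0 hK i g))
  have hex : ∀ g, ∃ l, Tendsto (fun n => cesaro Q n g x₀) (hyperfilter ℕ) (𝓝 l) := fun g => by
    obtain ⟨l, -, hl⟩ := isCompact_Icc.ultrafilter_le_nhds'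
      ((hyperfilter ℕ).map fun n => cesaro Q n g x₀)
      (Filter.mem_map.2 (Eventually.of_forall fun n => hbd n g))
    exact ⟨l, hl⟩
  choose Λ hΛ using hex
  let Λ' : CompactlySupportedContinuousMap X ℝ →ₚ[ℝ] ℝ :=
  { toFun := fun g => Λ g.toContinuousMap
    map_add' := fun g g' => by
      have h1 := (hΛ g.toContinuousMap).add (hΛ g'.toContinuousMap)
      refine tendsto_nhds_unique (hΛ _) (h1.congr fun n => ?_)
      rw [← ContinuousMap.add_apply, ← map_add]
      rfl
    map_smul' := fun c g => by
      have h1 := (hΛ g.toContinuousMap).const_mul c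
      refine tendsto_nhds_unique (hΛ _) (h1.congr fun n => ?_)
      rw [← smul_eq_mul, ← ContinuousMap.smul_apply, ← map_smul]
      rfl
    monotone' := fun g g' hgg' => by
      refine le_of_tendsto_of_tendsto' (hΛ _) (hΛ _) fun n => ?_
      rw [cesaro_apply, cesaro_apply]
      refine mul_le_mul_of_nonneg_left (Finset.sum_le_sum fun i _ => ?_) (by positivity)
      exact monotone_pow hQ i (show g.toContinuousMap ≤ g'.toContinuousMap from hgg') x₀ }
  set μ := RealRMK.rieszMeasure Λ'
  have hint : ∀ g : C(X, ℝ), ∫ x, g x ∂μ = Λ g := fun g =>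
    RealRMK.integral_rieszMeasure Λ' ⟨g, HasCompactSupport.of_compactSpace _⟩
  have hinv : ∀ g, Λ (Q g) = Λ g := fun g => by
    have h1 := (hΛ (Q g)).sub (hΛ g)
    simp only [← ContinuousMap.sub_apply, cesaro_apply_sub] at h1
    have h2 := (((continuous_eval_const (F := C(X, ℝ)) x₀).tendsto _).comp
      (tendsto_cesaro_remainder hQ hK0 hK g)).mono_left hF
    exact sub_eq_zero.1 (tendsto_nhds_unique h1 h2)
  have hone : 0 < μ.real Set.univ := by
    have h1 : k ≤ Λ 1 := ge_of_tendsto' (hΛ 1) fun n =>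
      cesaro_mem (convex_Ici k) n 1 x₀ fun i => hk i x₀
    rw [← hint] at h1
    simp only [ContinuousMap.one_apply, integral_const, smul_eq_mul, mul_one] at h1
    exact hk0.trans_le h1
  have hne := (ENNReal.toReal_pos_iff.1 hone)
  refine ⟨(μ Set.univ)⁻¹ • μ, ⟨?_⟩, fun g => ?_⟩
  · rw [Measure.smul_apply, smul_eq_mul, ENNReal.inv_mul_cancel hne.1.ne' hne.2.ne]
  · rw [integral_smul_measure, integral_smul_measure, hint, hint, hinv]

end PositiveOperator

/-! ### Existence of the eigenmeasure and the eigenfunction -/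

section Existence

variable {dI : I → I → ℝ} {θ β η : ℝ} {b : ℕ} {ζ : Fin b → I → I} {p : I} {f : Omega → ℝ}

/-- The nonnegative functions `g` with `g x ≤ exp(c d(x, y)^β) g y` for all `x, y`. -/
def distortionCone (dI : I → I → ℝ) (θ β c : ℝ) : Set (Omega → ℝ) :=
  {g | (∀ x, 0 ≤ g x) ∧ ∀ x y, g x ≤ Real.exp (c * latDist dI θ x y ^ β) * g y}

/-- Along each branch the exponents of `exp f` and `g` add up to `(|f|_β + c) η^β = c`, with `c` the
distortion exponent; integration over branches preserves the inequality. -/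
lemma transfer_mem_distortionCone [NeZero b] (hd : IsIntervalMetric dI)
    (hθ : θ ∈ Set.Ioo (0 : ℝ) 1) (hη : η ∈ Set.Ioo (0 : ℝ) 1) (hβ : 0 < β)
    (hζ : ∀ j x y, dI (ζ j x) (ζ j y) ≤ η * dI x y) (hf : MemC dI θ β p f)
    {g : Omega → ℝ} (hgc : Continuous g)
    (hg : g ∈ distortionCone dI θ β (distortionExponent dI θ β η p f)) :
    transfer ζ f g ∈ distortionCone dI θ β (distortionExponent dI θ β η p f) := by
  have hexp := distortionExponent_nonneg (dI := dI) (θ := θ) (p := p) (f := f) hη hβ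
  refine ⟨fun x => integral_nonneg fun ω => mul_nonneg (Real.exp_pos _).le (hg.1 _),
    fun x y => ?_⟩
  rw [transfer, transfer, ← integral_const_mul]
  refine integral_mono (integrable_transfer hf.1 hgc x)
    ((integrable_transfer hf.1 hgc y).const_mul _) fun ω => ?_
  have h1 := latDist_fullBranch_rpow_le hd hθ hη.1.le hβ hζ ω x y
  have h2 := (le_abs_self _).trans ((abs_sub_le_holderConst hd hθ hf.1 hf.holderConst_ne_top
    (fullBranch ζ ω x) (fullBranch ζ ω y)).trans
      (mul_le_mul_of_nonneg_left h1 ENNReal.toReal_nonneg))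
  have h3 : g (fullBranch ζ ω x) ≤ Real.exp (distortionExponent dI θ β η p f *
      (η ^ β * latDist dI θ x y ^ β)) * g (fullBranch ζ ω y) :=
    (hg.2 _ _).trans (mul_le_mul_of_nonneg_right
      (Real.exp_le_exp.2 (mul_le_mul_of_nonneg_left h1 hexp)) (hg.1 _))
  have h4 : Real.exp (f (fullBranch ζ ω x)) ≤ Real.exp ((holderConst dI θ β p f).toReal *
      (η ^ β * latDist dI θ x y ^ β)) * Real.exp (f (fullBranch ζ ω y)) := by
    rw [← Real.exp_add]
    exact Real.exp_le_exp.2 (by linarith)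
  refine (mul_le_mul h4 h3 (hg.1 _) (by positivity)).trans (le_of_eq ?_)
  rw [mul_mul_mul_comm, ← Real.exp_add, ← add_mul, ← mul_assoc (_ + _),
    distortionExponent_eq hη hβ]

/-- The transfer operator as a bounded operator on `C(Ω)`. -/
def transferCLM [NeZero b] (hζ : ∀ j, Continuous (ζ j)) (hf : Continuous f) :
    C(Omega, ℝ) →L[ℝ] C(Omega, ℝ) :=
  LinearMap.mkContinuous
    { toFun := fun g => ⟨transfer ζ f g, continuous_transfer hζ hf g.continuous⟩
      map_add' := fun g g' =>
        ContinuousMap.ext fun x => transfer_add hf g.continuous g'.continuous x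
      map_smul' := fun c g => ContinuousMap.ext fun x => transfer_const_mul c x }
    (Real.exp (exists_abs_bound hf).choose) fun g => by
      have hc := (exists_abs_bound hf).choose_spec.2
      refine (ContinuousMap.norm_le _ (by positivity)).2 fun x => ?_
      refine (norm_integral_le_of_norm_le_const (μ := branchMeasure b)
        (C := Real.exp (exists_abs_bound hf).choose * ‖g‖) (Eventually.of_forall fun ω => ?_)).trans
        (by simp)
      rw [norm_mul, Real.norm_of_nonneg (Real.exp_pos _).le]
      exact mul_le_mul (Real.exp_le_exp.2 ((le_abs_self _).trans (hc _))) (g.norm_coe_le_norm _)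
        (norm_nonneg _) (Real.exp_pos _).le

lemma monotone_transferCLM [NeZero b] (hζ : ∀ j, Continuous (ζ j)) (hf : Continuous f) :
    Monotone (transferCLM hζ hf) := fun g g' h x =>
  transfer_mono hf g.continuous g'.continuous h x

lemma isCompact_distortionCone_inter (hd : IsIntervalMetric dI) (hθ : θ ∈ Set.Ioo (0 : ℝ) 1)
    (hβ : 0 < β) (c m M : ℝ) :
    IsCompact {g : C(Omega, ℝ) | ⇑g ∈ distortionCone dI θ β c ∧ ∀ x, g x ∈ Set.Icc m M} := by
  have hlim : ∀ x, Tendsto (fun y => Real.exp (c * latDist dI θ x y ^ β)) (𝓝 x) (𝓝 1) :=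
    fun x => by
      simpa using ((tendsto_latDist_rpow hd hθ hβ x).const_mul c).rexp
  have hest : ∀ g : Omega → ℝ, g ∈ distortionCone dI θ β c → (∀ x, g x ≤ M) → ∀ x y,
      |g x - g y| ≤ |Real.exp (c * latDist dI θ x y ^ β) - 1| * M := by
    intro g hg hM x y
    have key : ∀ x y, g x - g y ≤ |Real.exp (c * latDist dI θ x y ^ β) - 1| * M := by
      intro x y
      calc g x - g y ≤ (Real.exp (c * latDist dI θ x y ^ β) - 1) * g y := by
            linarith [hg.2 x y]
        _ ≤ |Real.exp (c * latDist dI θ x y ^ β) - 1| * g y :=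
            mul_le_mul_of_nonneg_right (le_abs_self _) (hg.1 y)
        _ ≤ _ := mul_le_mul_of_nonneg_left (hM y) (abs_nonneg _)
    refine abs_sub_le_iff.2 ⟨key x y, ?_⟩
    rw [latDist_comm hd]
    exact key y x
  have hlim0 : ∀ x, Tendsto (fun y => |Real.exp (c * latDist dI θ x y ^ β) - 1| * M) (𝓝 x)
      (𝓝 0) := fun x => by
    simpa using (((hlim x).sub_const 1).abs).mul_const M
  refine ArzelaAscoli.isCompact_of_equicontinuous _ ?_ ?_
  · have himg : ContinuousMap.toFun '' {g : C(Omega, ℝ) | ⇑g ∈ distortionCone dI θ β c ∧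
        ∀ x, g x ∈ Set.Icc m M} = distortionCone dI θ β c ∩ Set.univ.pi fun _ => Set.Icc m M := by
      ext g
      constructor
      · rintro ⟨g, hg, rfl⟩
        exact ⟨hg.1, fun x _ => hg.2 x⟩
      · rintro ⟨hg, hgM⟩
        have hc : Continuous g := by
          refine continuous_iff_continuousAt.2 fun x => ?_
          rw [ContinuousAt, tendsto_iff_norm_sub_tendsto_zero]
          refine squeeze_zero (fun _ => norm_nonneg _) (fun y => ?_) (hlim0 x)
          rw [Real.norm_eq_abs, abs_sub_comm]
          exact hest g hg (fun x => (hgM x trivial).2) x y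
        exact ⟨⟨g, hc⟩, ⟨hg, fun x => hgM x trivial⟩, rfl⟩
    rw [himg]
    refine IsCompact.inter_left (isCompact_univ_pi fun _ => isCompact_Icc) ?_
    refine IsClosed.inter (s₁ := {g : Omega → ℝ | ∀ x, 0 ≤ g x})
      (s₂ := {g | ∀ x y, g x ≤ Real.exp (c * latDist dI θ x y ^ β) * g y}) ?_ ?_
    · simp only [Set.ofPred_forall]
      exact isClosed_iInter fun x => isClosed_le continuous_const (continuous_apply x)
    · simp only [Set.ofPred_forall]
      exact isClosed_iInter fun x => isClosed_iInter fun y =>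
        isClosed_le (continuous_apply x) (continuous_const.mul (continuous_apply y))
  · intro x
    refine Metric.equicontinuousAt_of_continuity_modulus _ (hlim0 x) _
      (Eventually.of_forall fun y g => ?_)
    exact hest g.1 g.2.1 (fun x => (g.2.2 x).2) x y

lemma mem_distortionCone_sum_smul {c : ℝ} {ι : Type*} (s : Finset ι) {w : ι → ℝ}
    {g : ι → Omega → ℝ} (hw : ∀ i, 0 ≤ w i) (hg : ∀ i, g i ∈ distortionCone dI θ β c) :
    (fun x => ∑ i ∈ s, w i * g i x) ∈ distortionCone dI θ β c := by
  refine ⟨fun x => Finset.sum_nonneg fun i _ => mul_nonneg (hw i) ((hg i).1 x), fun x y => ?_⟩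
  rw [Finset.mul_sum]
  refine Finset.sum_le_sum fun i _ => ?_
  rw [mul_left_comm]
  exact mul_le_mul_of_nonneg_left ((hg i).2 x y) (hw i)

theorem exists_eigenmeasure_eigenfunction [NeZero b] (hd : IsIntervalMetric dI)
    (hθ : θ ∈ Set.Ioo (0 : ℝ) 1) (hη : η ∈ Set.Ioo (0 : ℝ) 1) (hβ : 0 < β)
    (hζ : ∀ j x y, dI (ζ j x) (ζ j y) ≤ η * dI x y) (hf : MemC dI θ β p f) :
    ∃ (ν : Measure Omega) (h : Omega → ℝ), IsProbabilityMeasure ν ∧ IsEigenmeasure ζ p f ν ∧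
      IsEigenfunction dI θ β η ζ p f ν h := by
  have hζc : ∀ j, Continuous (ζ j) := fun j => continuous_of_dI_le hd (hζ j)
  have hexp := distortionExponent_nonneg (dI := dI) (θ := θ) (p := p) (f := f) hη hβ
  set c := distortionExponent dI θ β η p f with hc
  obtain ⟨D, hD, hDb⟩ := exists_latDist_bound hd hθ
  set T := transferCLM hζc hf.1 with hTdef
  have hT : Monotone T := monotone_transferCLM hζc hf.1
  set K := Real.exp (c * D ^ β)
  have hK0 : 0 < K := Real.exp_pos _
  have hcone : ∀ n, ⇑((T ^ n) 1) ∈ distortionCone dI θ β c := by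
    intro n
    induction n with
    | zero =>
      refine ⟨fun x => zero_le_one, fun x y => ?_⟩
      have := mul_nonneg hexp (Real.rpow_nonneg (latDist_nonneg hd hθ x y) β)
      simpa using this
    | succ n ih =>
      rw [pow_succ']
      exact transfer_mem_distortionCone hd hθ hη hβ hζ hf (ContinuousMap.continuous _) ih
  have hKT : ∀ n x y, (T ^ n) 1 x ≤ K * (T ^ n) 1 y := fun n x y =>
    ((hcone n).2 x y).trans (mul_le_mul_of_nonneg_right (Real.exp_le_exp.2
      (mul_le_mul_of_nonneg_left (Real.rpow_le_rpow (latDist_nonneg hd hθ _ _) (hDb x y) hβ.le)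
        hexp)) ((hcone n).1 y))
  -- Bounded oscillation gives `T^n 1 ≥ m` with a constant `m > 0`; positivity then yields `T^(n+1)
  -- 1 ≥ m • T 1 > 0`.
  have hpos : ∀ n x, 0 < (T ^ n) 1 x := by
    intro n
    induction n with
    | zero => exact fun x => zero_lt_one
    | succ n ih =>
      intro x
      set m := K⁻¹ * (T ^ n) 1 x with hm
      have hm0 : 0 < m := mul_pos (inv_pos.2 hK0) (ih x)
      have h1 : m • (1 : C(Omega, ℝ)) ≤ (T ^ n) 1 := fun y => by
        have h2 := hKT n x y
        rw [← inv_mul_le_iff₀ hK0] at h2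
        simpa [hm] using h2
      have h3 := hT h1 x
      rw [map_smul] at h3
      rw [pow_succ']
      exact (mul_pos hm0 (transfer_one_pos (ζ := ζ) hf.1 x)).trans_le h3
  obtain ⟨lam, hlam, hgrow⟩ := exists_growth_rate_of_monotone hT hpos hKT
  set Q : C(Omega, ℝ) →L[ℝ] C(Omega, ℝ) := lam⁻¹ • T with hQdef
  have hQpow : ∀ n g, (Q ^ n) g = (lam⁻¹) ^ n • (T ^ n) g := fun n g => by
    induction n with
    | zero => simp
    | succ n ih =>
      rw [pow_succ', pow_succ', pow_succ', mul_smul]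
      change lam⁻¹ • T ((Q ^ n) g) = lam⁻¹ • lam⁻¹ ^ n • T ((T ^ n) g)
      rw [ih, map_smul]
  have hQ : Monotone Q := fun g g' hgg' x =>
    mul_le_mul_of_nonneg_left (hT hgg' x) (inv_pos.2 hlam).le
  have hQ1 : ∀ n x, (Q ^ n) 1 x ∈ Set.Icc K⁻¹ K := fun n x => by
    have h1 := hgrow n x
    have h2 : (Q ^ n) 1 x = (T ^ n) 1 x / lam ^ n := by
      rw [hQpow, inv_pow, div_eq_inv_mul]
      rfl
    rw [h2]
    exact ⟨(le_div_iff₀ (pow_pos hlam n)).2 h1.1, (div_le_iff₀ (pow_pos hlam n)).2 h1.2⟩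
  have hQcone : ∀ n, ⇑(cesaro Q n 1) ∈ distortionCone dI θ β c := fun n => by
    have h1 : ⇑(cesaro Q n 1) = fun x => ∑ i ∈ Finset.range (n + 1),
        (((n : ℝ) + 1)⁻¹ * lam⁻¹ ^ i) * (T ^ i) 1 x := by
      funext x
      rw [cesaro_apply, Finset.mul_sum]
      refine Finset.sum_congr rfl fun i _ => ?_
      rw [hQpow, mul_assoc]
      rfl
    rw [h1]
    exact mem_distortionCone_sum_smul _ (fun i => by positivity) hcone
  obtain ⟨g, ⟨hgcone, hgK⟩, hQg⟩ := exists_fixed_function hQ hK0.le (fun n x => (hQ1 n x).2)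
    (isCompact_distortionCone_inter hd hθ hβ c K⁻¹ K)
    fun n => ⟨hQcone n, fun x => cesaro_mem (convex_Icc _ _) n 1 x fun i => hQ1 i x⟩
  obtain ⟨ν, hν, hinv⟩ := exists_invariant_measure hQ (inv_pos.2 hK0) (fun n x => (hQ1 n x).1)
    hK0.le (fun n x => (hQ1 n x).2)
  have hTQ : ∀ g x, T g x = lam * Q g x := fun g x => by
    change T g x = lam * (lam⁻¹ * T g x)
    rw [mul_inv_cancel_left₀ hlam.ne']
  have hop : ∀ Φ : C(Omega, ℝ), ∀ x, opP ζ p f Φ x = lam * Q Φ x := fun Φ x => by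
    rw [opP_eq_transfer hf.1 Φ.continuous, ← hTQ]
    rfl
  have hdual : ∀ Φ : C(Omega, ℝ), ∫ x, opP ζ p f Φ x ∂ν = lam * ∫ x, Φ x ∂ν := fun Φ => by
    simp only [hop, integral_const_mul, hinv]
  -- Testing duality on `Φ = 1` identifies the growth rate with the eigenvalue, since `ν` has mass
  -- one.
  have heig : eigval ζ p f ν = lam := by
    have h1 := hdual 1
    simp only [ContinuousMap.one_apply, integral_const, probReal_univ, smul_eq_mul,
      mul_one] at h1
    exact h1
  have hgint : 0 < ∫ x, g x ∂ν := by
    have h1 : K⁻¹ ≤ ∫ x, g x ∂ν := by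
      calc K⁻¹ = ∫ _, K⁻¹ ∂ν := by simp
        _ ≤ _ := integral_mono (integrable_const _)
            (g.continuous.integrable_of_hasCompactSupport (HasCompactSupport.of_compactSpace _))
            fun x => (hgK x).1
    exact (inv_pos.2 hK0).trans_le h1
  -- The fixed function satisfies `g ≥ K⁻¹`, so its integral is positive and it can be normalized to
  -- `∫ h dν = 1`.
  set r := (∫ x, g x ∂ν)⁻¹ with hr
  have hr0 : 0 < r := inv_pos.2 hgint
  refine ⟨ν, fun x => r * g x, hν, fun Φ hΦ => ?_, ⟨continuous_const.mul g.continuous,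
    fun x => mul_nonneg hr0.le (hgcone.1 x), ?_, fun x y => ?_⟩, fun x => ?_⟩
  · rw [heig]
    exact hdual ⟨Φ, hΦ⟩
  · rw [integral_const_mul, hr, inv_mul_cancel₀ hgint.ne']
  · rw [mul_left_comm]
    exact mul_le_mul_of_nonneg_left (hgcone.2 x y) hr0.le
  · have h1 := hop (r • g) x
    rw [map_smul, hQg] at h1
    rw [heig]
    exact h1

end Existence

end CoupledLattice

end

/-! ### Choice of constants and conclusion -/

theorem mainTheorem4
    (dI : unitInterval → unitInterval → ℝ) (hdI : CoupledLattice.IsIntervalMetric dI)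
    (θ : ℝ) (hθ : θ ∈ Set.Ioo (0 : ℝ) 1)
    (β : ℝ) (hβ : 0 < β)
    (η : ℝ) (hη : η ∈ Set.Ioo (0 : ℝ) 1)
    (τ : unitInterval → unitInterval) (b : ℕ) (ζ : Fin b → unitInterval → unitInterval)
    (hτ : CoupledLattice.IsFullBranchExpanding dI η τ b ζ)
    (p : unitInterval) (hp : Function.IsFixedPt τ p)
    (f : CoupledLattice.Omega → ℝ) (hf : CoupledLattice.MemC dI θ β p f) :
    (∃ (ν : Measure CoupledLattice.Omega) (h : CoupledLattice.Omega → ℝ),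
      IsProbabilityMeasure ν ∧ CoupledLattice.IsEigenmeasure ζ p f ν ∧
        CoupledLattice.IsEigenfunction dI θ β η ζ p f ν h) ∧
    ∀ (ν : Measure CoupledLattice.Omega) (h : CoupledLattice.Omega → ℝ),
      IsProbabilityMeasure ν → CoupledLattice.IsEigenmeasure ζ p f ν →
      CoupledLattice.IsEigenfunction dI θ β η ζ p f ν h →
      ∃ C₆ : ℝ, 0 < C₆ ∧
        ∀ (E : Equiv.Perm CoupledLattice.Omega) (CE : ℝ), CE ∈ Set.Ioo 0 η⁻¹ →
          CoupledLattice.IsCoupling dI θ E CE →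
          (∀ Φ : CoupledLattice.Omega → ℝ, CoupledLattice.MemC dI θ β p Φ →
            CoupledLattice.MemC dI θ β p (CoupledLattice.opCoupled ζ p f ν h E Φ)) ∧
          (∀ Φ : CoupledLattice.Omega → ℝ, CoupledLattice.MemC dI θ β p Φ → ∀ n : ℕ,
            CoupledLattice.holderConst dI θ β p
                ((CoupledLattice.opCoupled ζ p f ν h E)^[n] Φ) ≤
              CoupledLattice.holderConst dI θ β p Φ * ENNReal.ofReal ((CE * η) ^ (β * n)) +
                ENNReal.ofReal (C₆ * CE ^ β * ∑' i : ℕ, (CE * η) ^ (i * β)) *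
                  CoupledLattice.supNorm Φ) ∧
          ∃ θ₁ ∈ Set.Ioo (0 : ℝ) 1, ∃ C₂ : ℝ, 0 < C₂ ∧
            ∀ Φ : CoupledLattice.Omega → ℝ, CoupledLattice.MemC dI θ β p Φ → ∀ n : ℕ,
              CoupledLattice.holderConst dI θ β p
                  ((CoupledLattice.opCoupled ζ p f ν h E)^[n] Φ) ≤
                CoupledLattice.holderConst dI θ β p Φ * ENNReal.ofReal (θ₁ ^ n) +
                  ENNReal.ofReal C₂ * CoupledLattice.supNorm Φ := by
  have : NeZero b := ⟨hτ.branches_pos.ne'⟩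
  refine ⟨CoupledLattice.exists_eigenmeasure_eigenfunction hdI hθ hη hβ hτ.contracts hf, ?_⟩
  intro ν h hν _ hh
  have hc0 := CoupledLattice.distortionExponent_nonneg (dI := dI) (θ := θ) (p := p) (f := f) hη hβ
  set c := CoupledLattice.distortionExponent dI θ β η p f with hc
  -- The estimate needs only `4c`; the `1` makes the constant positive when `|f|_β = 0`.
  refine ⟨4 * c + 1, by linarith, fun E CE hCE hE => ?_⟩
  have hr : CE * η ∈ Set.Ioo (0 : ℝ) 1 :=
    ⟨mul_pos hCE.1 hη.1, by simpa using (lt_div_iff₀ hη.1).1 (by simpa using hCE.2)⟩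
  have hrβ := CoupledLattice.rpow_mem_Ioo hr hβ
  set r := (CE * η) ^ β with hrdef
  have hCEβ : 0 < CE ^ β := Real.rpow_pos_of_pos hCE.1 _
  have htsum : ∑' i : ℕ, (CE * η) ^ (i * β) = (1 - r)⁻¹ := by
    rw [← tsum_geometric_of_lt_one hrβ.1.le hrβ.2]
    refine tsum_congr fun i => ?_
    rw [mul_comm (i : ℝ), Real.rpow_mul hr.1.le, Real.rpow_natCast]
  have hgeom : ∀ n : ℕ, ∑ i ∈ Finset.range n, r ^ i ≤ (1 - r)⁻¹ := fun n => by
    rw [← tsum_geometric_of_lt_one hrβ.1.le hrβ.2]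
    exact (summable_geometric_of_lt_one hrβ.1.le hrβ.2).sum_le_tsum _
      fun i _ => pow_nonneg hrβ.1.le i
  have hinv : 0 < (1 - r)⁻¹ := inv_pos.2 (sub_pos.2 hrβ.2)
  have hiter := fun (Φ : CoupledLattice.Omega → ℝ) (hΦ : CoupledLattice.MemC dI θ β p Φ) =>
    CoupledLattice.opCoupled_iterate_bounds hdI hθ hη hβ hτ.contracts hf hh hCE.1 hE hΦ.1
      ENNReal.toReal_nonneg
      (CoupledLattice.abs_sub_le_holderConst hdI hθ hΦ.1 hΦ.holderConst_ne_top)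
      (CoupledLattice.abs_le_supNorm hΦ.supNorm_ne_top)
  have hmain : ∀ Φ : CoupledLattice.Omega → ℝ, CoupledLattice.MemC dI θ β p Φ → ∀ n : ℕ,
      CoupledLattice.holderConst dI θ β p ((CoupledLattice.opCoupled ζ p f ν h E)^[n] Φ) ≤
        CoupledLattice.holderConst dI θ β p Φ * ENNReal.ofReal (r ^ n) +
          ENNReal.ofReal ((4 * c + 1) * CE ^ β * (1 - r)⁻¹) * CoupledLattice.supNorm Φ := by
    intro Φ hΦ n
    set a := (CoupledLattice.holderConst dI θ β p Φ).toReal with ha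
    set s := (CoupledLattice.supNorm Φ).toReal with hs
    have ha0 : 0 ≤ a := ENNReal.toReal_nonneg
    have hs0 : 0 ≤ s := ENNReal.toReal_nonneg
    have hrn : 0 ≤ r ^ n := pow_nonneg hrβ.1.le n
    have hle : r ^ n * a + 4 * c * CE ^ β * s * ∑ i ∈ Finset.range n, r ^ i ≤
        a * r ^ n + (4 * c + 1) * CE ^ β * (1 - r)⁻¹ * s := by
      have h1 : 4 * c * CE ^ β * s * ∑ i ∈ Finset.range n, r ^ i ≤
          4 * c * CE ^ β * s * (1 - r)⁻¹ :=
        mul_le_mul_of_nonneg_left (hgeom n) (by positivity)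
      have h2 : 0 ≤ CE ^ β * s * (1 - r)⁻¹ := by positivity
      linarith
    refine (CoupledLattice.holderConst_le hdI hθ hβ (by positivity) fun x y =>
      ((hiter Φ hΦ n).2.2 x y).trans (mul_le_mul_of_nonneg_right hle (Real.rpow_nonneg
        (CoupledLattice.latDist_nonneg hdI hθ x y) _))).trans (le_of_eq ?_)
    rw [ENNReal.ofReal_add (by positivity) (by positivity), ENNReal.ofReal_mul ha0,
      ENNReal.ofReal_mul (by positivity), ha, hs, ENNReal.ofReal_toReal hΦ.holderConst_ne_top,
      ENNReal.ofReal_toReal hΦ.supNorm_ne_top]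
  -- Invariance of `𝒞` is the case `n = 1` of the iterated bounds. The final claim takes `θ₁ = (C_E
  -- η)^β` and, for `C₂`, the summed geometric series times `C₆ C_E^β`.
  refine ⟨fun Φ hΦ => ?_, fun Φ hΦ n => ?_, r, hrβ, (4 * c + 1) * CE ^ β * (1 - r)⁻¹,
    by positivity, hmain⟩
  · have h1 := hiter Φ hΦ 1
    have hsum : 0 ≤ ∑ i ∈ Finset.range 1, r ^ i :=
      Finset.sum_nonneg fun i _ => pow_nonneg hrβ.1.le i
    exact CoupledLattice.memC_of_bounds h1.1 (CoupledLattice.supNorm_le h1.2.1)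
      (CoupledLattice.holderConst_le hdI hθ hβ (add_nonneg
        (mul_nonneg (pow_nonneg hrβ.1.le 1) ENNReal.toReal_nonneg)
        (mul_nonneg (mul_nonneg (by positivity) ENNReal.toReal_nonneg) hsum)) h1.2.2)
  · rw [htsum, Real.rpow_mul hr.1.le, Real.rpow_natCast]
    exact hmain Φ hΦ n
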